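/- Let $d\ge 1$ be an integer, $0<\alpha<1$ and $0<p\le 1$. For a norm $|\cdot|$ on $\mathbb R^d$, let $\mathcal F_p([0,1]^d,|\cdot|^\alpha)$ be the Lipschitz free $p$-space over $[0,1]^d$ with the metric $|x-y|^\alpha$ and base point $0$, that is, the completion of the span of the evaluations $\delta(x)$, $x\in[0,1]^d$ (where $\delta(0)=0$), in the $p$-norm $\|m\|=\inf\big(\sum_i|a_i|^p\big)^{1/p}$, the infimum being over all finite representations $m=\sum_i a_i\,\frac{\delta(x_i)-\delta(y_i)}{|x_i-y_i|^\alpha}$ with $x_i\ne y_i$. (1) For every norm $|\cdot|$ on $\mathbb R^d$, the space $\mathcal F_p([0,1]^d,|\cdot|^\alpha)$ is isomorphic to $\ell_p$. (2) Let $|\cdot|=|\cdot|_1$ be the $\ell_1$ norm. Put $V_{-1}=\{0\}$, $V_k=[0,1]^d\cap 2^{-k}\mathbb Z^d$ for $k\ge 0$, and $V=\bigcup_{k\ge 0}V_k\setminus V_{k-1}$. For $R>0$, $u\in R\mathbb Z^d$ and $v\in\mathbb R^d$ put $\Lambda_R(u,v)=\prod_{i=1}^d\max\big(0,1-|v_i-u_i|/R\big)$.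 Then there is an isomorphism $T$ of $\ell_p(V)$ onto $\mathcal F_p([0,1]^d,|\cdot|_1^\alpha)$ with $$T e_v=2^{k\alpha}\Big(\delta(v)-\sum_{u\in V_{k-1}}\Lambda_{2^{-k+1}}(u,v)\,\delta(u)\Big)\qquad (v\in V_k\setminus V_{k-1},\ k\ge 0)$$ and $$\|T\|\,\|T^{-1}\|\le C(p,2^d)\,\rho^d\,\tau^d .$$ Here $C(q,n)=n^{1/q-1}$ and $$\rho=\Big(C(p,2)^p+\frac{(1+2^{1-p})\,2^{-p\alpha}}{1-2^{-p\alpha}}\Big)^{1/p},$$ $$\tau=C(p\alpha,d)^\alpha\; 2^{2/p}\Big(\frac1{1-2^{p(\alpha-1)}}\Big)^{1/p}\Big(\frac1{1-2^{-p\alpha}}\Big)^{1/p}\big(1+(d-1)^{p\alpha}\big)^{1/p}.$$ (3) Consequently the Banach–Mazur distance, i.e. the infimum of $\|S\|\,\|S^{-1}\|$ over all isomorphisms $S$ of $\mathcal F_p([0,1]^d,|\cdot|_1^\alpha)$ onto $\ell_p$, satisfies $d\big(\mathcal F_p([0,1]^d,|\cdot|_1^\alpha),\ell_p\big)\le C(p,2^d)\,\rho^d\,\tau^d$.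 -/

import Mathlib

open scoped BigOperators

noncomputable section

/-! ## Lipschitz free `p`-spaces

For a pointed metric space `(M, ρ, o)`, the space `𝒫(M) = span {δ(x) : x ∈ M}` with `δ(o) = 0` (and
no other linear relations between the `δ(x)`) carries the `p`-norm
`‖m‖ = inf (∑ |aᵢ|ᵖ)^(1/p)` over all representations `m = ∑ aᵢ μᵢ` by elementary molecules
`μᵢ = (δ(x) - δ(y)) / ρ(x, y)`, and `ℱ_p(M)` is its completion for the metric `‖x - y‖ᵖ`. -/

/-- The linear span `𝒫(M)` of the evaluations `δ(x)`, `x ∈ M`, with `δ(o) = 0`. The parameters `ρ`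
and `p` only serve to select the metric structure put on it below. -/
def MolSpan {M : Type*} (_ρ : MetricSpace M) (o : M) (_p : ℝ) : Type _ :=
  (M →₀ ℝ) ⧸ Submodule.span ℝ {Finsupp.single o (1 : ℝ)}

namespace MolSpan

section

variable {M : Type*} (ρ : MetricSpace M) (o : M) (p : ℝ)

instance instAddCommGroup : AddCommGroup (MolSpan ρ o p) :=
  inferInstanceAs (AddCommGroup ((M →₀ ℝ) ⧸ Submodule.span ℝ {Finsupp.single o (1 : ℝ)}))

instance instModule : Module ℝ (MolSpan ρ o p) :=
  inferInstanceAs (Module ℝ ((M →₀ ℝ) ⧸ Submodule.span ℝ {Finsupp.single o (1 : ℝ)}))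

/-- The canonical map `(M →₀ ℝ) → 𝒫(M)`. -/
def mkL : (M →₀ ℝ) →ₗ[ℝ] MolSpan ρ o p :=
  Submodule.mkQ (Submodule.span ℝ {Finsupp.single o (1 : ℝ)})

/-- The evaluation `δ(x)`. -/
def delta (x : M) : MolSpan ρ o p := mkL ρ o p (Finsupp.single x 1)

theorem delta_base : delta ρ o p o = 0 :=
  (Submodule.Quotient.mk_eq_zero _).2 (Submodule.subset_span rfl)

/-- The elementary molecule `(δ(x) - δ(y)) / ρ(x, y)`. -/
def molecule (x y : M) : MolSpan ρ o p :=
  (ρ.dist x y)⁻¹ • (delta ρ o p x - delta ρ o p y)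

/-- The sums `∑ |aᵢ|ᵖ` over all representations `m = ∑ aᵢ μᵢ` of `m` by elementary molecules. -/
def costs (m : MolSpan ρ o p) : Set ℝ :=
  {s | ∃ (n : ℕ) (a : Fin n → ℝ) (x y : Fin n → M), (∀ i, x i ≠ y i) ∧
    m = ∑ i, a i • molecule ρ o p (x i) (y i) ∧ s = ∑ i, |a i| ^ p}

/-- The `p`-th power `‖m‖ᵖ = inf ∑ |aᵢ|ᵖ` of the `p`-norm of `m ∈ 𝒫(M)`. -/
def powNorm (m : MolSpan ρ o p) : ℝ := sInf (costs ρ o p m)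

variable {ρ o p}

theorem costs_nonneg {m : MolSpan ρ o p} {s : ℝ} (hs : s ∈ costs ρ o p m) : 0 ≤ s := by
  obtain ⟨n, a, x, y, -, -, rfl⟩ := hs
  exact Finset.sum_nonneg fun i _ => Real.rpow_nonneg (abs_nonneg _) _

theorem costs_bddBelow (m : MolSpan ρ o p) : BddBelow (costs ρ o p m) :=
  ⟨0, fun _ hs => costs_nonneg hs⟩

theorem zero_mem_costs : (0 : ℝ) ∈ costs ρ o p 0 :=
  ⟨0, Fin.elim0, Fin.elim0, Fin.elim0, fun i => i.elim0, by simp, by simp⟩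

theorem add_mem_costs {m m' : MolSpan ρ o p} {s s' : ℝ} (h : s ∈ costs ρ o p m)
    (h' : s' ∈ costs ρ o p m') : s + s' ∈ costs ρ o p (m + m') := by
  obtain ⟨n, a, x, y, hxy, rfl, rfl⟩ := h
  obtain ⟨n', a', x', y', hxy', rfl, rfl⟩ := h'
  refine ⟨n + n', Fin.append a a', Fin.append x x', Fin.append y y', ?_, ?_, ?_⟩
  · intro i
    refine Fin.addCases (fun i => ?_) (fun i => ?_) i
    · simpa using hxy i
    · simpa using hxy' i
  · simp [Fin.sum_univ_add]
  · simp [Fin.sum_univ_add]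

theorem smul_mem_costs (c : ℝ) {m : MolSpan ρ o p} {s : ℝ} (h : s ∈ costs ρ o p m) :
    |c| ^ p * s ∈ costs ρ o p (c • m) := by
  obtain ⟨n, a, x, y, hxy, rfl, rfl⟩ := h
  refine ⟨n, fun i => c * a i, x, y, hxy, ?_, ?_⟩
  · simp [Finset.smul_sum, smul_smul]
  · simp [Finset.mul_sum, abs_mul, Real.mul_rpow (abs_nonneg _) (abs_nonneg _)]

theorem costs_delta_nonempty (x : M) : (costs ρ o p (delta ρ o p x)).Nonempty := by
  by_cases hx : x = o
  · subst hx
    rw [delta_base]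
    exact ⟨0, zero_mem_costs⟩
  · have hd : ρ.dist x o ≠ 0 := dist_ne_zero.2 hx
    refine ⟨_, 1, fun _ => ρ.dist x o, fun _ => x, fun _ => o, fun _ => hx, ?_, rfl⟩
    simp [molecule, delta_base, smul_smul, hd]

theorem costs_nonempty (m : MolSpan ρ o p) : (costs ρ o p m).Nonempty := by
  obtain ⟨f, rfl⟩ : ∃ f, mkL ρ o p f = m := Submodule.mkQ_surjective _ m
  induction f using Finsupp.induction_linear with
  | zero => rw [map_zero]; exact ⟨0, zero_mem_costs⟩
  | add f g hf hg =>
    rw [map_add]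
    exact ⟨_, add_mem_costs hf.some_mem hg.some_mem⟩
  | single x c =>
    have : mkL ρ o p (Finsupp.single x c) = c • delta ρ o p x := by
      rw [delta, ← map_smul, Finsupp.smul_single, smul_eq_mul, mul_one]
    rw [this]
    exact ⟨_, smul_mem_costs c (costs_delta_nonempty x).some_mem⟩

theorem powNorm_nonneg (m : MolSpan ρ o p) : 0 ≤ powNorm ρ o p m :=
  Real.sInf_nonneg fun _ hs => costs_nonneg hs

theorem powNorm_le {m : MolSpan ρ o p} {s : ℝ} (h : s ∈ costs ρ o p m) : powNorm ρ o p m ≤ s :=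
  csInf_le (costs_bddBelow m) h

theorem powNorm_zero : powNorm ρ o p 0 = 0 :=
  le_antisymm (powNorm_le zero_mem_costs) (powNorm_nonneg 0)

theorem powNorm_add_le (m m' : MolSpan ρ o p) :
    powNorm ρ o p (m + m') ≤ powNorm ρ o p m + powNorm ρ o p m' := by
  refine le_of_forall_pos_le_add fun ε hε => ?_
  obtain ⟨s, hs, hs'⟩ := exists_lt_of_csInf_lt (costs_nonempty m)
    (show sInf (costs ρ o p m) < powNorm ρ o p m + ε / 2 from lt_add_of_pos_right _ (by linarith))
  obtain ⟨t, ht, ht'⟩ := exists_lt_of_csInf_lt (costs_nonempty m')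
    (show sInf (costs ρ o p m') < powNorm ρ o p m' + ε / 2 from lt_add_of_pos_right _ (by linarith))
  linarith [powNorm_le (add_mem_costs hs ht)]

theorem powNorm_smul_le (c : ℝ) (m : MolSpan ρ o p) :
    powNorm ρ o p (c • m) ≤ |c| ^ p * powNorm ρ o p m := by
  have h0 : 0 ≤ |c| ^ p := Real.rpow_nonneg (abs_nonneg c) p
  rw [powNorm, powNorm, ← smul_eq_mul, ← Real.sInf_smul_of_nonneg h0]
  refine le_csInf ((costs_nonempty m).smul_set) ?_
  rintro _ ⟨s, hs, rfl⟩
  exact powNorm_le (smul_mem_costs c hs)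

theorem powNorm_neg (m : MolSpan ρ o p) : powNorm ρ o p (-m) = powNorm ρ o p m := by
  have key : ∀ m : MolSpan ρ o p, powNorm ρ o p (-m) ≤ powNorm ρ o p m := fun m => by
    simpa using powNorm_smul_le (-1) m
  exact le_antisymm (key m) (by simpa using key (-m))

variable (ρ o p)

/-- `𝒫(M)` with the metric `‖m - m'‖ᵖ`: in this instance, `norm` is the `p`-th power `‖·‖ᵖ` of the
`p`-norm, which is subadditive. -/
instance instSeminormedAddCommGroup : SeminormedAddCommGroup (MolSpan ρ o p) :=
  AddGroupSeminorm.toSeminormedAddCommGroup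
    { toFun := powNorm ρ o p
      map_zero' := powNorm_zero
      add_le' := powNorm_add_le
      neg' := powNorm_neg }

theorem norm_eq_powNorm (m : MolSpan ρ o p) : ‖m‖ = powNorm ρ o p m := rfl

instance instUniformContinuousConstSMul : UniformContinuousConstSMul ℝ (MolSpan ρ o p) where
  uniformContinuous_const_smul c := by
    refine (LipschitzWith.of_dist_le_mul (K := (|c| ^ p).toNNReal) fun m m' => ?_).uniformContinuous
    rw [dist_eq_norm, dist_eq_norm, ← smul_sub, norm_eq_powNorm, norm_eq_powNorm,
      Real.coe_toNNReal _ (Real.rpow_nonneg (abs_nonneg c) p)]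
    exact powNorm_smul_le c (m - m')

end

end MolSpan

/-- The Lipschitz free `p`-space `ℱ_p(M)` over the pointed metric space `(M, ρ, o)`: the completion
of `𝒫(M)`. -/
def LipFree {M : Type*} (ρ : MetricSpace M) (o : M) (p : ℝ) : Type _ :=
  UniformSpace.Completion (MolSpan ρ o p)

namespace LipFree

section

variable {M : Type*} (ρ : MetricSpace M) (o : M) (p : ℝ)

instance instAddCommGroup : AddCommGroup (LipFree ρ o p) :=
  inferInstanceAs (AddCommGroup (UniformSpace.Completion (MolSpan ρ o p)))

instance instModule : Module ℝ (LipFree ρ o p) :=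
  inferInstanceAs (Module ℝ (UniformSpace.Completion (MolSpan ρ o p)))

/-- The `p`-norm of `ℱ_p(M)`. The norm of the completion extends `‖·‖ᵖ`, hence the exponent. -/
instance instNorm : Norm (LipFree ρ o p) where
  norm x := (norm (E := UniformSpace.Completion (MolSpan ρ o p)) x) ^ (1 / p)

/-- The canonical embedding `δ : M → ℱ_p(M)`. -/
def delta (x : M) : LipFree ρ o p :=
  ((MolSpan.delta ρ o p x : MolSpan ρ o p) : UniformSpace.Completion (MolSpan ρ o p))

end

end LipFree

/-! ## Isomorphisms of quasi-normed spaces and the Banach–Mazur distance -/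

/-- The linear bijection `T` is an isomorphism: `T` and `T⁻¹` are bounded. -/
def IsIsomorphism {E F : Type*} [AddCommGroup E] [Module ℝ E] [Norm E] [AddCommGroup F] [Module ℝ F]
    [Norm F] (T : E ≃ₗ[ℝ] F) : Prop :=
  (∃ C : ℝ, ∀ x, ‖T x‖ ≤ C * ‖x‖) ∧ ∃ C : ℝ, ∀ y, ‖T.symm y‖ ≤ C * ‖y‖

/-- The operator norm `‖T‖`, the least `C ≥ 0` with `‖T x‖ ≤ C ‖x‖` for all `x`. It is only used for
bounded `T`. -/
def opNorm {E F : Type*} [AddCommGroup E] [Module ℝ E] [Norm E] [AddCommGroup F] [Module ℝ F]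
    [Norm F] (T : E ≃ₗ[ℝ] F) : ℝ :=
  sInf {C : ℝ | 0 ≤ C ∧ ∀ x, ‖T x‖ ≤ C * ‖x‖}

/-- The Banach–Mazur distance `inf ‖T‖ ‖T⁻¹‖` over all isomorphisms `T` of `E` onto `F`
(with value `∞` if there are none). -/
def banachMazurDist (E F : Type*) [AddCommGroup E] [Module ℝ E] [Norm E] [AddCommGroup F]
    [Module ℝ F] [Norm F] : ENNReal :=
  ⨅ (T : E ≃ₗ[ℝ] F) (_ : IsIsomorphism T), ENNReal.ofReal (opNorm T * opNorm T.symm)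

/-- The space `ℓ_p(ι)`, with its `p`-norm `‖f‖ = (∑ |f i|ᵖ)^(1/p)`. -/
abbrev Ellp (ι : Type*) (p : ℝ) : Type _ := lp (fun _ : ι => ℝ) (ENNReal.ofReal p)

open Classical in
/-- The unit vector `e_i` of `ℓ_p(ι)`. -/
def unitVec {ι : Type*} (p : ℝ) (i : ι) : Ellp ι p :=
  lp.single (E := fun _ : ι => ℝ) (ENNReal.ofReal p) i (1 : ℝ)

/-! ## The cube `[0, 1]^d` with Hölder distorted metrics -/

/-- The cube `[0, 1]^d`. -/
abbrev UnitCube (d : ℕ) : Type := Fin d → unitInterval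

/-- A point of the cube as a vector in `ℝ^d`. -/
def UnitCube.toVec {d : ℕ} (x : UnitCube d) : Fin d → ℝ := fun i => (x i : ℝ)

/-- The metric `|x - y|^α` on `[0, 1]^d`, for a norm `|·| = N` on `ℝ^d` and `0 < α < 1`. -/
@[reducible]
def holderMetric {d : ℕ} (N : Seminorm ℝ (Fin d → ℝ)) (hN : ∀ x, N x = 0 → x = 0) (α : ℝ)
    (h0 : 0 < α) (h1 : α < 1) : MetricSpace (UnitCube d) where
  dist x y := N (x.toVec - y.toVec) ^ α
  dist_self x := by simp [Real.zero_rpow h0.ne']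
  dist_comm x y := by rw [map_sub_rev]
  dist_triangle x y z := by
    have h : N (x.toVec - z.toVec) ≤ N (x.toVec - y.toVec) + N (y.toVec - z.toVec) := by
      simpa using map_add_le_add N (x.toVec - y.toVec) (y.toVec - z.toVec)
    calc N (x.toVec - z.toVec) ^ α
        ≤ (N (x.toVec - y.toVec) + N (y.toVec - z.toVec)) ^ α :=
          Real.rpow_le_rpow (apply_nonneg _ _) h h0.le
      _ ≤ _ := by
          have := NNReal.rpow_add_le_add_rpow
            ⟨N (x.toVec - y.toVec), apply_nonneg _ _⟩ ⟨N (y.toVec - z.toVec), apply_nonneg _ _⟩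
            h0.le h1.le
          exact_mod_cast this
  eq_of_dist_eq_zero {x y} h := by
    have h' : x.toVec - y.toVec = 0 :=
      hN _ ((Real.rpow_eq_zero (apply_nonneg _ _) h0.ne').1 h)
    funext i
    exact Subtype.ext (sub_eq_zero.1 (congrFun h' i))

/-- The norm `|x|_1 = ∑ |x_i|` on `ℝ^d`. -/
def l1Norm (d : ℕ) : Seminorm ℝ (Fin d → ℝ) :=
  Seminorm.of (fun x => ∑ i, |x i|)
    (fun x y => by
      rw [← Finset.sum_add_distrib]
      exact Finset.sum_le_sum fun i _ => abs_add_le (x i) (y i))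
    (fun c x => by simp [abs_mul, Finset.mul_sum])

theorem l1Norm_definite {d : ℕ} (x : Fin d → ℝ) (h : l1Norm d x = 0) : x = 0 := by
  have h' : ∑ i, |x i| = 0 := h
  funext i
  exact abs_eq_zero.1
    ((Finset.sum_eq_zero_iff_of_nonneg fun i _ => abs_nonneg (x i)).1 h' i (Finset.mem_univ i))

/-- The Lipschitz free `p`-space `ℱ_p([0, 1]^d, |·|^α)` with base point `0`. -/
abbrev CubeFree {d : ℕ} (N : Seminorm ℝ (Fin d → ℝ)) (hN : ∀ x, N x = 0 → x = 0) (α : ℝ)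
    (h0 : 0 < α) (h1 : α < 1) (p : ℝ) : Type :=
  LipFree (holderMetric N hN α h0 h1) (0 : UnitCube d) p

/-! ## Dyadic points and the hat basis -/

/-- The point `2^{-k} j` of `[0, 1]^d`, for `j ∈ {0, …, 2^k}^d`. -/
def gridPoint {d : ℕ} (k : ℕ) (j : Fin d → Fin (2 ^ k + 1)) : UnitCube d := fun i =>
  ⟨((j i : ℕ) : ℝ) / 2 ^ k, by positivity, by
    rw [div_le_one (by positivity)]
    exact_mod_cast Nat.lt_succ_iff.1 (j i).2⟩

/-- The grid `V_k = [0, 1]^d ∩ 2^{-k} ℤ^d`. -/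
def grid (d k : ℕ) : Set (UnitCube d) := Set.range (gridPoint k)

/-- `V_k \ V_{k-1}`, where `V_{-1} = {0}`. -/
def newPoints (d : ℕ) : ℕ → Set (UnitCube d)
  | 0 => grid d 0 \ {0}
  | k + 1 => grid d (k + 1) \ grid d k

/-- The set `V = ⋃_k V_k \ V_{k-1}` of nonzero dyadic points of the cube. -/
def dyadicPoints (d : ℕ) : Set (UnitCube d) := ⋃ k, newPoints d k

/-- The coordinatewise affine interpolation coefficient
`Λ_R(u, v) = ∏ max (0, 1 - |v_i - u_i| / R)` for vertices `u` of the lattice `R ℤ^d`. -/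
def hatCoeff {d : ℕ} (R : ℝ) (u v : UnitCube d) : ℝ :=
  ∏ i, max 0 (1 - |(v i : ℝ) - (u i : ℝ)| / R)

/-- The hat element `2^{kα} (δ(v) - ∑_{u ∈ V_{k-1}} Λ_{2^{-k+1}}(u, v) δ(u))`, for `v ∈ V_k`. For
`k = 0` the sum has the only term `u = 0`, and `δ(0) = 0`. -/
def hatElement {d : ℕ} (ρ : MetricSpace (UnitCube d)) (α p : ℝ) :
    ℕ → UnitCube d → LipFree ρ (0 : UnitCube d) p
  | 0, v => LipFree.delta ρ 0 p v
  | k + 1, v => (2 : ℝ) ^ (((k + 1 : ℕ) : ℝ) * α) • (LipFree.delta ρ 0 p v -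
      ∑ j : Fin d → Fin (2 ^ k + 1),
        hatCoeff ((2 : ℝ) ^ k)⁻¹ (gridPoint k j) v • LipFree.delta ρ 0 p (gridPoint k j))

/-! ## The constants -/

/-- `C(p, n) = n^(1/p - 1)`. -/
def constC (p : ℝ) (n : ℕ) : ℝ := (n : ℝ) ^ (1 / p - 1)

/-- `ρ = (C(p, 2)^p + (1 + 2^{1-p}) 2^{-pα} / (1 - 2^{-pα}))^{1/p}`. -/
def constRho (α p : ℝ) : ℝ :=
  (constC p 2 ^ p + (1 + 2 ^ (1 - p)) * 2 ^ (-(p * α)) * (1 / (1 - 2 ^ (-(p * α))))) ^ (1 / p)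

/-- `τ = C(pα, d)^α 2^{2/p} (1 - 2^{p(α-1)})^{-1/p} (1 - 2^{-pα})^{-1/p} (1 + (d-1)^{pα})^{1/p}`. -/
def constTau (d : ℕ) (α p : ℝ) : ℝ :=
  constC (p * α) d ^ α * 2 ^ (2 / p) * (1 / (1 - 2 ^ (p * (α - 1)))) ^ (1 / p) *
    (1 / (1 - 2 ^ (-(p * α)))) ^ (1 / p) * (1 + ((d : ℝ) - 1) ^ (p * α)) ^ (1 / p)

end

noncomputable section


/-! ## The tent function -/

/-- The tent function `s ↦ max (0, 1 - |s|)`. -/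
def tent (s : ℝ) : ℝ := max 0 (1 - |s|)

theorem tent_nonneg (s : ℝ) : 0 ≤ tent s := le_max_left _ _

theorem tent_le_one (s : ℝ) : tent s ≤ 1 :=
  max_le zero_le_one (by linarith [abs_nonneg s])

theorem tent_eq_zero {s : ℝ} (h : 1 ≤ |s|) : tent s = 0 := max_eq_left (by linarith)

theorem tent_eq {s : ℝ} (h : |s| ≤ 1) : tent s = 1 - |s| := max_eq_right (by linarith)

theorem abs_lt_one_of_tent_ne_zero {s : ℝ} (h : tent s ≠ 0) : |s| < 1 := by
  by_contra hs
  exact h (tent_eq_zero (not_lt.1 hs))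

theorem abs_tent_sub_le (s r : ℝ) : |tent s - tent r| ≤ |s - r| := by
  have h := abs_max_sub_max_le_max (0 : ℝ) (1 - |s|) 0 (1 - |r|)
  refine h.trans (max_le (by simp) ?_)
  have : 1 - |s| - (1 - |r|) = |r| - |s| := by ring
  rw [this, abs_sub_comm s r]
  exact abs_abs_sub_abs_le r s

theorem tent_intCast (z : ℤ) : tent z = if z = 0 then 1 else 0 := by
  split_ifs with h
  · simp [h, tent]
  · apply tent_eq_zero
    rw [← Int.cast_abs]
    exact_mod_cast Int.one_le_abs h

/-- The dilated tent is affine between consecutive integers. -/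
theorem tent_div_interpolate {m : ℕ} (hm : 1 ≤ m) (z : ℤ) {θ : ℝ} (h0 : 0 ≤ θ) (h1 : θ ≤ 1) :
    (1 - θ) * tent (z / m) + θ * tent ((z + 1) / m) = tent ((z + θ) / m) := by
  have hm0 : (0 : ℝ) < m := by exact_mod_cast hm
  rcases le_or_gt (m : ℤ) z with hz | hz
  · have hz' : (m : ℝ) ≤ z := by exact_mod_cast hz
    have key : ∀ t : ℝ, (m : ℝ) ≤ t → tent (t / m) = 0 := fun t ht =>
      tent_eq_zero (le_trans ((one_le_div hm0).2 ht) (le_abs_self _))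
    rw [key _ hz', key _ (by linarith), key _ (by linarith)]; ring
  rcases le_or_gt 0 z with hz0 | hz0
  · have hz' : (z : ℝ) + 1 ≤ m := by exact_mod_cast hz
    have hz0' : (0 : ℝ) ≤ z := by exact_mod_cast hz0
    have key : ∀ t : ℝ, 0 ≤ t → t ≤ m → tent (t / m) = 1 - t / m := fun t ht ht' => by
      have h0 : 0 ≤ t / m := by positivity
      have h1 : t / m ≤ 1 := (div_le_one hm0).2 ht'
      rw [tent_eq (by rwa [abs_of_nonneg h0]), abs_of_nonneg h0]
    rw [key _ hz0' (by linarith), key _ (by linarith) hz', key _ (by linarith) (by linarith)]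
    ring
  have hz0' : (z : ℝ) + 1 ≤ 0 := by exact_mod_cast hz0
  rcases le_or_gt (-(m : ℤ)) z with hzm | hzm
  · have hzm' : -(m : ℝ) ≤ z := by exact_mod_cast hzm
    have key : ∀ t : ℝ, t ≤ 0 → -(m : ℝ) ≤ t → tent (t / m) = 1 + t / m := fun t ht ht' => by
      have h0 : t / m ≤ 0 := div_nonpos_of_nonpos_of_nonneg ht hm0.le
      have h1 : -1 ≤ t / m := by rw [le_div_iff₀ hm0]; linarith
      rw [tent_eq (by rw [abs_of_nonpos h0]; linarith), abs_of_nonpos h0]; ring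
    rw [key _ (by linarith) hzm', key _ hz0' (by linarith), key _ (by linarith) (by linarith)]
    ring
  · have hzm' : (z : ℝ) + 1 ≤ -m := by
      have : z + 1 ≤ -(m : ℤ) := hzm
      exact_mod_cast this
    have key : ∀ t : ℝ, t ≤ -(m : ℝ) → tent (t / m) = 0 := fun t ht => by
      apply tent_eq_zero
      have : t / m ≤ -1 := by rw [div_le_iff₀ hm0]; linarith
      exact le_trans (by linarith) (neg_le_abs _)
    rw [key _ (by linarith), key _ hzm', key _ (by linarith)]; ring

theorem exists_cell {n : ℕ} (hn : 1 ≤ n) {b : ℝ} (hb0 : 0 ≤ b) (hb1 : b ≤ n) :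
    ∃ j < n, ∃ θ : ℝ, 0 ≤ θ ∧ θ ≤ 1 ∧ b = j + θ := by
  rcases hb1.lt_or_eq with h | h
  · exact ⟨⌊b⌋₊, (Nat.floor_lt hb0).2 h, b - ⌊b⌋₊, sub_nonneg.2 (Nat.floor_le hb0),
      by linarith [Nat.lt_floor_add_one b], by ring⟩
  · refine ⟨n - 1, by omega, 1, zero_le_one, le_rfl, ?_⟩
    rw [h, Nat.cast_sub hn]; simp

theorem sum_tent_mul {n j : ℕ} (hj : j < n) {θ : ℝ} (h0 : 0 ≤ θ) (h1 : θ ≤ 1) (g : ℕ → ℝ) :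
    ∑ i : Fin (n + 1), tent (j + θ - (i : ℕ)) * g i = (1 - θ) * g j + θ * g (j + 1) := by
  rw [Fin.sum_univ_eq_sum_range (fun i => tent (j + θ - (i : ℕ)) * g i),
    ← Finset.sum_subset (s₁ := {j, j + 1})]
  · rw [Finset.sum_pair (by omega)]
    have e1 : tent (j + θ - j) = 1 - θ := by
      rw [add_sub_cancel_left, tent_eq (by rwa [abs_of_nonneg h0]), abs_of_nonneg h0]
    have e2 : tent (j + θ - (j + 1 : ℕ)) = θ := by
      have : (j : ℝ) + θ - (j + 1 : ℕ) = -(1 - θ) := by push_cast; ring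
      have h : |1 - θ| = 1 - θ := abs_of_nonneg (by linarith)
      rw [this, tent_eq (by rw [abs_neg, h]; linarith), abs_neg, h]; ring
    rw [e1, e2]
  · intro i hi
    simp only [Finset.mem_insert, Finset.mem_singleton] at hi
    rw [Finset.mem_range]; omega
  · intro i _ hi
    simp only [Finset.mem_insert, Finset.mem_singleton, not_or] at hi
    rw [tent_eq_zero, zero_mul]
    rcases lt_or_ge i j with h | h
    · have : (i : ℝ) + 1 ≤ j := by exact_mod_cast h
      exact le_trans (by linarith) (le_abs_self _)
    · have : (j : ℝ) + 2 ≤ i := by exact_mod_cast (by omega : j + 2 ≤ i)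
      exact le_trans (by linarith) (neg_le_abs _)

theorem sum_tent {n : ℕ} (hn : 1 ≤ n) {b : ℝ} (hb0 : 0 ≤ b) (hb1 : b ≤ n) :
    ∑ i : Fin (n + 1), tent (b - (i : ℕ)) = 1 := by
  obtain ⟨j, hj, θ, h0, h1, rfl⟩ := exists_cell hn hb0 hb1
  simpa using sum_tent_mul hj h0 h1 (fun _ => 1)

/-- Piecewise affine interpolation on a finer grid reproduces a tent with integer peak. -/
theorem sum_tent_mul_tent {n m : ℕ} (hn : 1 ≤ n) (hm : 1 ≤ m) {b : ℝ} (hb0 : 0 ≤ b) (hb1 : b ≤ n)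
    (c : ℤ) :
    ∑ i : Fin (n + 1), tent (b - (i : ℕ)) * tent (((i : ℕ) : ℝ) / m - c) = tent (b / m - c) := by
  obtain ⟨j, hj, θ, h0, h1, rfl⟩ := exists_cell hn hb0 hb1
  have hm0 : (m : ℝ) ≠ 0 := by positivity
  rw [sum_tent_mul hj h0 h1 (fun i => tent ((i : ℝ) / m - c))]
  have h := tent_div_interpolate hm ((j : ℤ) - m * c) h0 h1
  have e1 : ((((j : ℤ) - m * c : ℤ)) : ℝ) / m = j / m - c := by push_cast; field_simp
  have e2 : (((((j : ℤ) - m * c : ℤ)) : ℝ) + 1) / m = ((j + 1 : ℕ) : ℝ) / m - c := by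
    push_cast; field_simp; ring
  have e3 : (((((j : ℤ) - m * c : ℤ)) : ℝ) + θ) / m = (j + θ) / m - c := by
    push_cast; field_simp; ring
  rwa [e1, e2, e3] at h

theorem card_tent_ne_zero_le (n : ℕ) {b : ℝ} (hb : 0 ≤ b) :
    (Finset.univ.filter fun i : Fin (n + 1) => tent (b - (i : ℕ)) ≠ 0).card ≤ 2 := by
  refine le_trans (Finset.card_le_card_of_injOn (t := {⌊b⌋₊, ⌊b⌋₊ + 1}) Fin.val ?_
    Fin.val_injective.injOn) Finset.card_le_two
  intro i hi
  have hi' := abs_lt.1 (abs_lt_one_of_tent_ne_zero (Finset.mem_filter.1 hi).2)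
  have h1 : ⌊b⌋₊ < (i : ℕ) + 1 := (Nat.floor_lt hb).2 (by push_cast; linarith)
  have h2 : (i : ℕ) < ⌊b⌋₊ + 2 := by
    have := Nat.lt_floor_add_one b
    have h3 : ((i : ℕ) : ℝ) < (⌊b⌋₊ + 2 : ℕ) := by push_cast; linarith
    exact_mod_cast h3
  simp only [Finset.coe_insert, Finset.coe_singleton, Set.mem_insert_iff, Set.mem_singleton_iff]
  omega

theorem abs_prod_sub_prod_le {ι : Type*} (s : Finset ι) {f g : ι → ℝ} (hf : ∀ i, |f i| ≤ 1)
    (hg : ∀ i, |g i| ≤ 1) : |∏ i ∈ s, f i - ∏ i ∈ s, g i| ≤ ∑ i ∈ s, |f i - g i| := by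
  classical
  induction s using Finset.induction_on with
  | empty => simp
  | insert a s ha ih =>
    rw [Finset.prod_insert ha, Finset.prod_insert ha, Finset.sum_insert ha]
    have hP : |∏ i ∈ s, g i| ≤ 1 := by
      rw [Finset.abs_prod]
      exact Finset.prod_le_one (fun _ _ => abs_nonneg _) fun i _ => hg i
    have e : f a * ∏ i ∈ s, f i - g a * ∏ i ∈ s, g i
        = (f a - g a) * ∏ i ∈ s, g i + f a * (∏ i ∈ s, f i - ∏ i ∈ s, g i) := by ring
    rw [e]
    refine (abs_add_le _ _).trans (add_le_add ?_ ?_)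
    · rw [abs_mul]
      exact mul_le_of_le_one_right (abs_nonneg _) hP
    · rw [abs_mul]
      exact (mul_le_of_le_one_left (abs_nonneg _) (hf a)).trans ih

/-! ## Grids and hat coefficients -/

section Grid

variable {d : ℕ}

theorem gridPoint_apply (k : ℕ) (j : Fin d → Fin (2 ^ k + 1)) (i : Fin d) :
    ((gridPoint k j i : unitInterval) : ℝ) = ((j i : ℕ) : ℝ) / 2 ^ k := rfl

theorem gridPoint_injective (k : ℕ) : Function.Injective (gridPoint (d := d) k) := by
  intro j j' h
  funext i
  have h' : ((gridPoint k j i : unitInterval) : ℝ) = (gridPoint k j' i : unitInterval) := by rw [h]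
  rw [gridPoint_apply, gridPoint_apply, div_left_inj' (by positivity)] at h'
  exact Fin.ext (by exact_mod_cast h')

theorem grid_subset_succ (k : ℕ) : grid d k ⊆ grid d (k + 1) := by
  rintro _ ⟨j, rfl⟩
  refine ⟨fun i => ⟨2 * (j i : ℕ), by have := (j i).2; rw [pow_succ]; omega⟩, ?_⟩
  funext i
  apply Subtype.ext
  rw [gridPoint_apply, gridPoint_apply]
  push_cast
  rw [pow_succ]; field_simp

theorem grid_mono : Monotone (grid d) := monotone_nat_of_le_succ grid_subset_succ

theorem zero_mem_grid (k : ℕ) : (0 : UnitCube d) ∈ grid d k := by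
  refine ⟨fun _ => 0, ?_⟩
  funext i
  apply Subtype.ext
  rw [gridPoint_apply]
  simp

theorem newPoints_subset_grid (k : ℕ) : newPoints d k ⊆ grid d k := by
  cases k <;> exact Set.sdiff_subset

theorem ne_zero_of_mem_newPoints {k : ℕ} {v : UnitCube d} (hv : v ∈ newPoints d k) : v ≠ 0 := by
  rintro rfl
  cases k with
  | zero => exact hv.2 rfl
  | succ k => exact hv.2 (zero_mem_grid k)

theorem notMem_grid_of_lt {k l : ℕ} {v : UnitCube d} (hv : v ∈ newPoints d k) (h : l < k) :
    v ∉ grid d l := by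
  cases k with
  | zero => omega
  | succ k => exact fun h' => hv.2 (grid_mono (Nat.lt_succ_iff.1 h) h')

theorem newPoints_level_unique {k l : ℕ} {v : UnitCube d} (hk : v ∈ newPoints d k)
    (hl : v ∈ newPoints d l) : k = l := by
  rcases lt_trichotomy k l with h | h | h
  · exact absurd (newPoints_subset_grid k hk) (notMem_grid_of_lt hl h)
  · exact h
  · exact absurd (newPoints_subset_grid l hl) (notMem_grid_of_lt hk h)

theorem mem_grid_zero_or_newPoints {k : ℕ} {v : UnitCube d} (hv : v ∈ grid d k) :
    v = 0 ∨ ∃ l ≤ k, v ∈ newPoints d l := by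
  induction k with
  | zero =>
    by_cases h : v = 0
    · exact Or.inl h
    · exact Or.inr ⟨0, le_rfl, hv, h⟩
  | succ k ih =>
    by_cases h : v ∈ grid d k
    · exact (ih h).imp_right fun ⟨l, hl, hl'⟩ => ⟨l, hl.trans k.le_succ, hl'⟩
    · exact Or.inr ⟨k + 1, le_rfl, hv, h⟩

theorem hatCoeff_gridPoint (k : ℕ) (j : Fin d → Fin (2 ^ k + 1)) (x : UnitCube d) :
    hatCoeff ((2 : ℝ) ^ k)⁻¹ (gridPoint k j) x = ∏ i, tent (2 ^ k * (x i : ℝ) - (j i : ℕ)) := by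
  refine Finset.prod_congr rfl fun i _ => ?_
  have h2 : (0 : ℝ) < 2 ^ k := by positivity
  have : (2 : ℝ) ^ k * (x i : ℝ) - (j i : ℕ) = ((x i : ℝ) - (gridPoint k j i : ℝ)) * 2 ^ k := by
    rw [gridPoint_apply]; field_simp
  rw [tent, this, abs_mul, abs_of_pos h2, div_inv_eq_mul]

theorem hatCoeff_nonneg (R : ℝ) (u x : UnitCube d) : 0 ≤ hatCoeff R u x :=
  Finset.prod_nonneg fun _ _ => le_max_left _ _

theorem hatCoeff_le_one {R : ℝ} (hR : 0 ≤ R) (u x : UnitCube d) : hatCoeff R u x ≤ 1 :=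
  Finset.prod_le_one (fun _ _ => le_max_left _ _) fun i _ =>
    max_le zero_le_one (by linarith [div_nonneg (abs_nonneg ((x i : ℝ) - u i)) hR])

theorem hatCoeff_gridPoint_gridPoint (k : ℕ) (j j' : Fin d → Fin (2 ^ k + 1)) :
    hatCoeff ((2 : ℝ) ^ k)⁻¹ (gridPoint k j) (gridPoint k j') = if j = j' then 1 else 0 := by
  rw [hatCoeff_gridPoint]
  have key : ∀ i, tent (2 ^ k * ((gridPoint k j' i : unitInterval) : ℝ) - (j i : ℕ))
      = if j i = j' i then 1 else 0 := fun i => by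
    have e : (2 : ℝ) ^ k * ((gridPoint k j' i : unitInterval) : ℝ) - (j i : ℕ)
        = (((j' i : ℕ) : ℤ) - ((j i : ℕ) : ℤ) : ℤ) := by
      rw [gridPoint_apply]; push_cast; field_simp
    rw [e, tent_intCast]
    refine if_congr ?_ rfl rfl
    rw [Fin.ext_iff]; omega
  rw [Finset.prod_congr rfl fun i _ => key i, Finset.prod_ite_zero]
  simp [funext_iff]

theorem hatCoeff_of_mem_grid {k : ℕ} {v w : UnitCube d} (hv : v ∈ grid d k) (hw : w ∈ grid d k)
    (h : v ≠ w) : hatCoeff ((2 : ℝ) ^ k)⁻¹ v w = 0 := by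
  obtain ⟨j, rfl⟩ := hv
  obtain ⟨j', rfl⟩ := hw
  rw [hatCoeff_gridPoint_gridPoint, if_neg fun e => h (by rw [e])]

theorem hatCoeff_self {k : ℕ} {v : UnitCube d} (hv : v ∈ grid d k) :
    hatCoeff ((2 : ℝ) ^ k)⁻¹ v v = 1 := by
  obtain ⟨j, rfl⟩ := hv
  rw [hatCoeff_gridPoint_gridPoint, if_pos rfl]

theorem scaled_coord_nonneg (k : ℕ) (x : UnitCube d) (i : Fin d) : 0 ≤ (2 : ℝ) ^ k * (x i : ℝ) :=
  mul_nonneg (by positivity) (x i).2.1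

theorem scaled_coord_le (k : ℕ) (x : UnitCube d) (i : Fin d) :
    (2 : ℝ) ^ k * (x i : ℝ) ≤ (2 ^ k : ℕ) := by
  push_cast
  exact mul_le_of_le_one_right (by positivity) (x i).2.2

theorem sum_hatCoeff (k : ℕ) (x : UnitCube d) :
    ∑ j : Fin d → Fin (2 ^ k + 1), hatCoeff ((2 : ℝ) ^ k)⁻¹ (gridPoint k j) x = 1 := by
  simp_rw [hatCoeff_gridPoint]
  have h := Finset.prod_univ_sum (fun _ : Fin d => (Finset.univ : Finset (Fin (2 ^ k + 1))))
    (fun i j => tent (2 ^ k * (x i : ℝ) - (j : ℕ)))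
  rw [Fintype.piFinset_univ] at h
  rw [← h]
  exact Finset.prod_eq_one fun i _ =>
    sum_tent Nat.one_le_two_pow (scaled_coord_nonneg k x i) (scaled_coord_le k x i)

/-- Multi-affine interpolation on `V_n` reproduces the hat functions of the coarser grids. -/
theorem sum_hatCoeff_mul_hatCoeff {k n : ℕ} (hkn : k ≤ n) {v : UnitCube d} (hv : v ∈ grid d k)
    (x : UnitCube d) :
    ∑ j : Fin d → Fin (2 ^ n + 1), hatCoeff ((2 : ℝ) ^ n)⁻¹ (gridPoint n j) x *
      hatCoeff ((2 : ℝ) ^ k)⁻¹ v (gridPoint n j) = hatCoeff ((2 : ℝ) ^ k)⁻¹ v x := by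
  obtain ⟨l, rfl⟩ := hv
  obtain ⟨r, rfl⟩ := Nat.exists_eq_add_of_le hkn
  simp_rw [hatCoeff_gridPoint, ← Finset.prod_mul_distrib]
  have h := Finset.prod_univ_sum (fun _ : Fin d => (Finset.univ : Finset (Fin (2 ^ (k + r) + 1))))
    (fun i j => tent (2 ^ (k + r) * (x i : ℝ) - (j : ℕ)) *
      tent (((j : ℕ) : ℝ) / (2 ^ r : ℕ) - ((l i : ℕ) : ℤ)))
  rw [Fintype.piFinset_univ] at h
  refine Eq.trans (Finset.sum_congr rfl fun j _ => Finset.prod_congr rfl fun i _ => ?_)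
    (h.symm.trans (Finset.prod_congr rfl fun i _ => ?_))
  · rw [gridPoint_apply]
    congr 2
    generalize ((j i : ℕ) : ℝ) = s
    push_cast
    rw [pow_add]; field_simp
  · rw [sum_tent_mul_tent Nat.one_le_two_pow Nat.one_le_two_pow (scaled_coord_nonneg _ x i)
      (scaled_coord_le _ x i)]
    congr 1
    push_cast
    rw [pow_add]; field_simp

theorem card_hatCoeff_ne_zero_le (k : ℕ) (x : UnitCube d) :
    (Finset.univ.filter fun j : Fin d → Fin (2 ^ k + 1) =>
      hatCoeff ((2 : ℝ) ^ k)⁻¹ (gridPoint k j) x ≠ 0).card ≤ 2 ^ d := by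
  have hsub : (Finset.univ.filter fun j : Fin d → Fin (2 ^ k + 1) =>
      hatCoeff ((2 : ℝ) ^ k)⁻¹ (gridPoint k j) x ≠ 0) ⊆ Fintype.piFinset fun i =>
        Finset.univ.filter fun l : Fin (2 ^ k + 1) => tent (2 ^ k * (x i : ℝ) - (l : ℕ)) ≠ 0 := by
    intro j hj
    rw [Finset.mem_filter, hatCoeff_gridPoint, Finset.prod_ne_zero_iff] at hj
    rw [Fintype.mem_piFinset]
    exact fun i => Finset.mem_filter.2 ⟨Finset.mem_univ _, hj.2 i (Finset.mem_univ i)⟩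
  refine (Finset.card_le_card hsub).trans ?_
  rw [Fintype.card_piFinset]
  refine (Finset.prod_le_pow_card _ _ 2 fun i _ =>
    card_tent_ne_zero_le _ (scaled_coord_nonneg k x i)).trans ?_
  simp

theorem abs_hatCoeff_sub_le_one {R : ℝ} (hR : 0 ≤ R) (u x y : UnitCube d) :
    |hatCoeff R u x - hatCoeff R u y| ≤ 1 :=
  abs_sub_le_iff.2 ⟨by linarith [hatCoeff_le_one hR u x, hatCoeff_nonneg R u y],
    by linarith [hatCoeff_le_one hR u y, hatCoeff_nonneg R u x]⟩

theorem l1Norm_apply (x : Fin d → ℝ) : l1Norm d x = ∑ i, |x i| := rfl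

theorem abs_hatCoeff_sub_le (k : ℕ) (j : Fin d → Fin (2 ^ k + 1)) (x y : UnitCube d) :
    |hatCoeff ((2 : ℝ) ^ k)⁻¹ (gridPoint k j) x - hatCoeff ((2 : ℝ) ^ k)⁻¹ (gridPoint k j) y|
      ≤ 2 ^ k * l1Norm d (x.toVec - y.toVec) := by
  rw [hatCoeff_gridPoint, hatCoeff_gridPoint, l1Norm_apply, Finset.mul_sum]
  have h1 : ∀ s, |tent s| ≤ 1 := fun s => by
    rw [abs_of_nonneg (tent_nonneg s)]; exact tent_le_one s
  refine (abs_prod_sub_prod_le _ (fun _ => h1 _) fun _ => h1 _).trans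
    (Finset.sum_le_sum fun i _ => (abs_tent_sub_le _ _).trans_eq ?_)
  have : (2 : ℝ) ^ k * (x i : ℝ) - (j i : ℕ) - (2 ^ k * (y i : ℝ) - (j i : ℕ))
      = 2 ^ k * ((x i : ℝ) - y i) := by ring
  rw [this, abs_mul, abs_of_pos (by positivity : (0 : ℝ) < 2 ^ k)]
  rfl

theorem sum_hatCoeff_sub_rpow_le (k : ℕ) (x y : UnitCube d) {p : ℝ} (hp : 0 < p) :
    ∑ j : Fin d → Fin (2 ^ k + 1), |hatCoeff ((2 : ℝ) ^ k)⁻¹ (gridPoint k j) x -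
      hatCoeff ((2 : ℝ) ^ k)⁻¹ (gridPoint k j) y| ^ p
      ≤ 2 ^ (d + 1) * (min 1 (2 ^ k * l1Norm d (x.toVec - y.toVec))) ^ p := by
  classical
  set S : UnitCube d → Finset (Fin d → Fin (2 ^ k + 1)) := fun z =>
    Finset.univ.filter fun j => hatCoeff ((2 : ℝ) ^ k)⁻¹ (gridPoint k j) z ≠ 0 with hS
  have hm : 0 ≤ min 1 (2 ^ k * l1Norm d (x.toVec - y.toVec)) :=
    le_min zero_le_one (mul_nonneg (by positivity) (apply_nonneg _ _))
  rw [← Finset.sum_subset (Finset.subset_univ (S x ∪ S y))]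
  · refine (Finset.sum_le_card_nsmul _ _ ((min 1 (2 ^ k * l1Norm d (x.toVec - y.toVec))) ^ p)
      fun j _ => Real.rpow_le_rpow (abs_nonneg _) (le_min
        (abs_hatCoeff_sub_le_one (by positivity) _ _ _) (abs_hatCoeff_sub_le k j x y)) hp.le).trans ?_
    rw [nsmul_eq_mul]
    refine mul_le_mul_of_nonneg_right ?_ (Real.rpow_nonneg hm p)
    have : (S x ∪ S y).card ≤ 2 ^ (d + 1) := by
      refine (Finset.card_union_le _ _).trans ?_
      have h1 := card_hatCoeff_ne_zero_le k x
      have h2 := card_hatCoeff_ne_zero_le k y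
      rw [pow_succ]; simp only [hS]; omega
    exact_mod_cast this
  · intro j _ hj
    simp only [hS, Finset.mem_union, Finset.mem_filter, Finset.mem_univ, true_and, not_or,
      not_not] at hj
    rw [hj.1, hj.2]
    simp [Real.zero_rpow hp.ne']

end Grid


/-! ## `p`-normed groups: sums against `ℓ_p` coefficients and coordinate maps into `ℓ_p` -/

theorem abs_sum_rpow_le {ι : Type*} (s : Finset ι) (f : ι → ℝ) {p : ℝ} (hp0 : 0 < p) (hp1 : p ≤ 1) :
    |∑ i ∈ s, f i| ^ p ≤ ∑ i ∈ s, |f i| ^ p := by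
  classical
  induction s using Finset.induction_on with
  | empty => simp [Real.zero_rpow hp0.ne']
  | insert a s ha ih =>
    rw [Finset.sum_insert ha, Finset.sum_insert ha]
    calc |f a + ∑ i ∈ s, f i| ^ p ≤ (|f a| + |∑ i ∈ s, f i|) ^ p :=
          Real.rpow_le_rpow (abs_nonneg _) (abs_add_le _ _) hp0.le
      _ ≤ |f a| ^ p + |∑ i ∈ s, f i| ^ p :=
          Real.rpow_add_le_add_rpow (abs_nonneg _) (abs_nonneg _) hp0.le hp1
      _ ≤ _ := by gcongr

section Lp

variable {ι : Type*} {p : ℝ}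

theorem Ellp.summable_rpow (hp : 0 < p) (f : Ellp ι p) : Summable fun i => |f i| ^ p := by
  have h := (lp.memℓp f).summable (by rwa [ENNReal.toReal_ofReal hp.le])
  simpa only [ENNReal.toReal_ofReal hp.le, Real.norm_eq_abs] using h

theorem Ellp.norm_eq (hp : 0 < p) (f : Ellp ι p) : ‖f‖ = (∑' i, |f i| ^ p) ^ (1 / p) := by
  have h := lp.norm_eq_tsum_rpow (p := ENNReal.ofReal p) (by rwa [ENNReal.toReal_ofReal hp.le]) f
  simpa only [ENNReal.toReal_ofReal hp.le, Real.norm_eq_abs] using h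

/-- Relabelling the coordinates of `ℓ_p`. -/
def Ellp.reindex {κ : Type*} (e : ι ≃ κ) (hp : 0 < p) : Ellp ι p ≃ₗ[ℝ] Ellp κ p where
  toFun f := ⟨fun k => f (e.symm k), memℓp_gen <| by
    simpa only [ENNReal.toReal_ofReal hp.le, Real.norm_eq_abs, Function.comp_def] using
      (e.symm.summable_iff (f := fun i => |f i| ^ p)).2 (Ellp.summable_rpow hp f)⟩
  invFun f := ⟨fun i => f (e i), memℓp_gen <| by
    simpa only [ENNReal.toReal_ofReal hp.le, Real.norm_eq_abs, Function.comp_def] using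
      (e.summable_iff (f := fun i => |f i| ^ p)).2 (Ellp.summable_rpow hp f)⟩
  map_add' f g := rfl
  map_smul' c f := rfl
  left_inv f := lp.ext (funext fun i => congrArg f (e.symm_apply_apply i))
  right_inv f := lp.ext (funext fun k => congrArg f (e.apply_symm_apply k))

theorem Ellp.norm_reindex {κ : Type*} (e : ι ≃ κ) (hp : 0 < p) (f : Ellp ι p) :
    ‖Ellp.reindex e hp f‖ = ‖f‖ := by
  rw [Ellp.norm_eq hp, Ellp.norm_eq hp]
  exact congrArg (· ^ (1 / p)) (e.symm.tsum_eq fun i => |f i| ^ p)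

theorem Ellp.norm_reindex_symm {κ : Type*} (e : ι ≃ κ) (hp : 0 < p) (f : Ellp κ p) :
    ‖(Ellp.reindex e hp).symm f‖ = ‖f‖ := by
  rw [← Ellp.norm_reindex e hp, LinearEquiv.apply_symm_apply]

end Lp

section Synthesis

theorem norm_coeff_smul_le {ι X : Type*} [NormedAddCommGroup X] [Module ℝ X] {p C : ℝ}
    (hX : ∀ (c : ℝ) (x : X), ‖c • x‖ ≤ |c| ^ p * ‖x‖) {h : ι → X} (hC : ∀ i, ‖h i‖ ≤ C) (f : Ellp ι p) (i : ι) : ‖f i • h i‖ ≤ |f i| ^ p * C :=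
  (hX _ _).trans (mul_le_mul_of_nonneg_left (hC i) (Real.rpow_nonneg (abs_nonneg _) p))

theorem summable_norm_coeff_smul {ι X : Type*} [NormedAddCommGroup X] [Module ℝ X] {p C : ℝ}
    (hX : ∀ (c : ℝ) (x : X), ‖c • x‖ ≤ |c| ^ p * ‖x‖) {h : ι → X} (hC : ∀ i, ‖h i‖ ≤ C)
    (hp : 0 < p) (f : Ellp ι p) : Summable fun i => ‖f i • h i‖ :=
  Summable.of_nonneg_of_le (fun _ => norm_nonneg _) (norm_coeff_smul_le hX hC f)
    ((Ellp.summable_rpow hp f).mul_right C)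

variable {ι X : Type*} [NormedAddCommGroup X] [CompleteSpace X] [Module ℝ X] [ContinuousConstSMul ℝ X]
  {p C : ℝ} (hX : ∀ (c : ℝ) (x : X), ‖c • x‖ ≤ |c| ^ p * ‖x‖) {h : ι → X} (hC : ∀ i, ‖h i‖ ≤ C)

/-- The map `f ↦ ∑ f i • h i` on `ℓ_p`, for a bounded family `h` in a complete `p`-normed group. -/
def synthesis (hp : 0 < p) : Ellp ι p →ₗ[ℝ] X where
  toFun f := ∑' i, f i • h i
  map_add' f g := by
    rw [← ((summable_norm_coeff_smul hX hC hp f).of_norm).tsum_add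
      (summable_norm_coeff_smul hX hC hp g).of_norm]
    exact tsum_congr fun i => add_smul (f i) (g i) (h i)
  map_smul' c f := by
    rw [RingHom.id_apply, ← ((summable_norm_coeff_smul hX hC hp f).of_norm).tsum_const_smul c]
    exact tsum_congr fun i => mul_smul c (f i) (h i)

theorem hasSum_synthesis (hp : 0 < p) (f : Ellp ι p) :
    HasSum (fun i => f i • h i) (synthesis hX hC hp f) :=
  (summable_norm_coeff_smul hX hC hp f).of_norm.hasSum

theorem norm_synthesis_le (hp : 0 < p) (f : Ellp ι p) :
    ‖synthesis hX hC hp f‖ ≤ C * ∑' i, |f i| ^ p := by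
  rw [mul_comm, ← tsum_mul_right]
  exact (norm_tsum_le_tsum_norm (summable_norm_coeff_smul hX hC hp f)).trans
    ((summable_norm_coeff_smul hX hC hp f).tsum_le_tsum (norm_coeff_smul_le hX hC f)
      ((Ellp.summable_rpow hp f).mul_right C))

theorem synthesis_unitVec (hp : 0 < p) (i : ι) : synthesis hX hC hp (unitVec p i) = h i := by
  classical
  have e : ∀ j, (unitVec p i : Ellp ι p) j = if j = i then 1 else 0 := fun j => by
    rw [unitVec, lp.single_apply, Pi.single_apply]
  refine (hasSum_synthesis hX hC hp _).unique ?_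
  convert hasSum_ite_eq i (h i) using 2 with j
  rw [e]; split_ifs with hj
  · rw [hj, one_smul]
  · rw [zero_smul]

end Synthesis

section Analysis

open UniformSpace

theorem continuous_coordinate {ι E : Type*} [SeminormedAddCommGroup E] [Module ℝ E] {p M : ℝ}
    {φ : ι → E →ₗ[ℝ] ℝ} (hφ : ∀ (F : Finset ι) (m : E), ∑ i ∈ F, |φ i m| ^ p ≤ M * ‖m‖) (hp : 0 < p) (i : ι) : Continuous (φ i) := by
  refine continuous_of_continuousAt_zero (φ i) ?_
  rw [ContinuousAt, map_zero]
  have h1 : ∀ m, ‖φ i m‖ ≤ (M * ‖m‖) ^ (1 / p) := fun m => by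
    have h := hφ {i} m
    rw [Finset.sum_singleton] at h
    have h' := Real.rpow_le_rpow (Real.rpow_nonneg (abs_nonneg _) p) h
      (by positivity : 0 ≤ 1 / p)
    rwa [← Real.rpow_mul (abs_nonneg _), mul_one_div_cancel hp.ne', Real.rpow_one] at h'
  refine squeeze_zero_norm h1 ?_
  have h2 : Continuous fun m : E => (M * ‖m‖) ^ (1 / p) :=
    (continuous_const.mul continuous_norm).rpow_const fun _ => Or.inr (by positivity)
  have h3 := h2.tendsto 0
  rwa [norm_zero, mul_zero, Real.zero_rpow (by positivity)] at h3

variable {ι E : Type*} [SeminormedAddCommGroup E] [Module ℝ E]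
  {p M : ℝ} {φ : ι → E →ₗ[ℝ] ℝ}
  (hφ : ∀ (F : Finset ι) (m : E), ∑ i ∈ F, |φ i m| ^ p ≤ M * ‖m‖)

/-- The extension of the coordinate functional `φ i` to the completion. -/
def coordinateExt (hp : 0 < p) (i : ι) : Completion E →+ ℝ :=
  (φ i : E →ₗ[ℝ] ℝ).toAddMonoidHom.extension (continuous_coordinate hφ hp i)

theorem coordinateExt_coe (hp : 0 < p) (i : ι) (m : E) :
    coordinateExt hφ hp i (m : Completion E) = φ i m :=
  AddMonoidHom.extension_coe _ (continuous_coordinate hφ hp i) m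

theorem continuous_coordinateExt (hp : 0 < p) (i : ι) : Continuous (coordinateExt hφ hp i) :=
  AddMonoidHom.continuous_extension _ (continuous_coordinate hφ hp i)

theorem sum_coordinateExt_le (hp : 0 < p) (F : Finset ι) (x : Completion E) :
    ∑ i ∈ F, |coordinateExt hφ hp i x| ^ p ≤ M * ‖x‖ := by
  induction x using Completion.induction_on with
  | hp =>
    refine isClosed_le ?_ (continuous_norm.const_mul M)
    exact continuous_finsetSum F fun i _ =>
      ((continuous_coordinateExt hφ hp i).abs).rpow_const fun _ => Or.inr hp.le
  | ih m =>
    rw [Completion.norm_coe]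
    simp_rw [coordinateExt_coe]
    exact hφ F m

variable [UniformContinuousConstSMul ℝ E]

theorem norm_completion_smul_le (hE : ∀ (c : ℝ) (m : E), ‖c • m‖ ≤ |c| ^ p * ‖m‖)
    (c : ℝ) (x : Completion E) : ‖c • x‖ ≤ |c| ^ p * ‖x‖ := by
  induction x using Completion.induction_on with
  | hp =>
    have h := continuous_const_smul (T := Completion E) c
    exact isClosed_le h.norm (continuous_norm.const_mul _)
  | ih m => rw [← Completion.coe_smul, Completion.norm_coe, Completion.norm_coe]; exact hE c m

theorem coordinateExt_smul (hp : 0 < p) (i : ι) (c : ℝ) (x : Completion E) :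
    coordinateExt hφ hp i (c • x) = c * coordinateExt hφ hp i x := by
  have hc := continuous_coordinateExt hφ hp i
  induction x using Completion.induction_on with
  | hp => exact isClosed_eq (hc.comp (continuous_const_smul c)) (continuous_const.mul hc)
  | ih m => rw [← Completion.coe_smul, coordinateExt_coe, coordinateExt_coe, map_smul, smul_eq_mul]

/-- The coordinate map `x ↦ (φ i x)_i` of the completion into `ℓ_p`. -/
def analysis (hp : 0 < p) : Completion E →ₗ[ℝ] Ellp ι p where
  toFun x := ⟨fun i => coordinateExt hφ hp i x, memℓp_gen' (C := M * ‖x‖) fun F => by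
    simpa only [ENNReal.toReal_ofReal hp.le, Real.norm_eq_abs] using
      sum_coordinateExt_le hφ hp F x⟩
  map_add' x y := lp.ext (funext fun i => map_add (coordinateExt hφ hp i) x y)
  map_smul' c x := lp.ext (funext fun i => coordinateExt_smul hφ hp i c x)

theorem tsum_analysis_le (hp : 0 < p) (x : Completion E) :
    ∑' i, |analysis hφ hp x i| ^ p ≤ M * ‖x‖ :=
  (Ellp.summable_rpow hp _).tsum_le_of_sum_le fun F => sum_coordinateExt_le hφ hp F x

theorem analysis_synthesis {C : ℝ} (hp : 0 < p)
    (hX : ∀ (c : ℝ) (x : Completion E), ‖c • x‖ ≤ |c| ^ p * ‖x‖) {h : ι → E}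
    (hC : ∀ i, ‖(h i : Completion E)‖ ≤ C)
    (hself : ∀ i, φ i (h i) = 1) (hne : ∀ i j, i ≠ j → φ i (h j) = 0) (f : Ellp ι p) :
    analysis hφ hp (synthesis hX hC hp f) = f := by
  refine lp.ext (funext fun i => ?_)
  have h1 := (hasSum_synthesis hX hC hp f).map (coordinateExt hφ hp i)
    (continuous_coordinateExt hφ hp i)
  refine h1.unique ?_
  have e : (coordinateExt hφ hp i : Completion E → ℝ) ∘ (fun j => f j • (h j : Completion E))
      = fun j => f j * φ i (h j) := funext fun j => by
    rw [Function.comp_apply, coordinateExt_smul, coordinateExt_coe]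
  rw [e]
  have := hasSum_single (f := fun j => f j * φ i (h j)) i fun j hj => by
    rw [hne i j hj.symm, mul_zero]
  rwa [hself, mul_one] at this

end Analysis


/-! ## Functionals and norm estimates on `𝒫(M)` -/

namespace MolSpan

section

variable {M : Type*} {ρ : MetricSpace M} {o : M} {p : ℝ}

/-- The functional on `𝒫(M)` induced by a function vanishing at the base point. -/
def lift (f : M → ℝ) (hf : f o = 0) : MolSpan ρ o p →ₗ[ℝ] ℝ :=
  Submodule.liftQ _ (Finsupp.linearCombination ℝ f) <| by
    rw [Submodule.span_le, Set.singleton_subset_iff]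
    simp [hf]

theorem lift_delta (f : M → ℝ) (hf : f o = 0) (x : M) :
    lift (ρ := ρ) (p := p) f hf (delta ρ o p x) = f x :=
  (Submodule.liftQ_apply _ _ _).trans (by simp)

theorem mem_of_delta_mem (S : Submodule ℝ (MolSpan ρ o p)) (h : ∀ x, delta ρ o p x ∈ S)
    (m : MolSpan ρ o p) : m ∈ S := by
  obtain ⟨f, rfl⟩ : ∃ f, mkL ρ o p f = m := Submodule.mkQ_surjective _ m
  induction f using Finsupp.induction_linear with
  | zero => rw [map_zero]; exact S.zero_mem
  | add f g hf hg => rw [map_add]; exact S.add_mem hf hg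
  | single x c =>
    have : mkL ρ o p (Finsupp.single x c) = c • delta ρ o p x := by
      rw [delta, ← map_smul, Finsupp.smul_single, smul_eq_mul, mul_one]
    rw [this]
    exact S.smul_mem c (h x)

theorem norm_smul_le (c : ℝ) (m : MolSpan ρ o p) : ‖c • m‖ ≤ |c| ^ p * ‖m‖ := powNorm_smul_le c m

theorem norm_delta_sub_le (x y : M) :
    ‖delta ρ o p x - delta ρ o p y‖ ≤ ρ.dist x y ^ p := by
  have h0 : 0 ≤ ρ.dist x y := @dist_nonneg M ρ.toPseudoMetricSpace x y
  by_cases h : x = y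
  · rw [h, sub_self, norm_zero]
    exact Real.rpow_nonneg (@dist_nonneg M ρ.toPseudoMetricSpace y y) p
  · have hd : ρ.dist x y ≠ 0 := dist_ne_zero.2 h
    refine powNorm_le ⟨1, fun _ => ρ.dist x y, fun _ => x, fun _ => y, fun _ => h, ?_, ?_⟩
    · simp [molecule, smul_smul, hd]
    · simp [abs_of_nonneg h0]

/-- A family of functionals that is `ℓ_p`-bounded on molecules is `ℓ_p`-bounded. -/
theorem sum_functionals_rpow_le {ι : Type*} (hp0 : 0 < p) (hp1 : p ≤ 1)
    (φ : ι → MolSpan ρ o p →ₗ[ℝ] ℝ) {K : ℝ} (hK0 : 0 ≤ K) (F : Finset ι)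
    (hK : ∀ x y, ∑ i ∈ F, |φ i (delta ρ o p x) - φ i (delta ρ o p y)| ^ p ≤ K * ρ.dist x y ^ p)
    (m : MolSpan ρ o p) : ∑ i ∈ F, |φ i m| ^ p ≤ K * ‖m‖ := by
  rw [norm_eq_powNorm, powNorm, ← smul_eq_mul, ← Real.sInf_smul_of_nonneg hK0]
  refine le_csInf ((costs_nonempty m).smul_set) ?_
  rintro _ ⟨_, ⟨n, a, x, y, hxy, rfl, rfl⟩, rfl⟩
  have h1 : ∀ j, ∑ i ∈ F, |φ i (molecule ρ o p (x j) (y j))| ^ p ≤ K := fun j => by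
    have hd : 0 < ρ.dist (x j) (y j) := dist_pos.2 (hxy j)
    have e : ∀ i, |φ i (molecule ρ o p (x j) (y j))| ^ p = (ρ.dist (x j) (y j) ^ p)⁻¹ *
        |φ i (delta ρ o p (x j)) - φ i (delta ρ o p (y j))| ^ p := fun i => by
      rw [molecule, map_smul, map_sub, smul_eq_mul, abs_mul,
        Real.mul_rpow (abs_nonneg _) (abs_nonneg _), abs_of_pos (inv_pos.2 hd),
        Real.inv_rpow hd.le]
    simp_rw [e]
    rw [← Finset.mul_sum, inv_mul_le_iff₀ (Real.rpow_pos_of_pos hd p), mul_comm]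
    exact hK _ _
  calc ∑ i ∈ F, |φ i (∑ j, a j • molecule ρ o p (x j) (y j))| ^ p
      ≤ ∑ i ∈ F, ∑ j, |a j| ^ p * |φ i (molecule ρ o p (x j) (y j))| ^ p := by
        refine Finset.sum_le_sum fun i _ => ?_
        rw [map_sum]
        refine (abs_sum_rpow_le _ _ hp0 hp1).trans_eq (Finset.sum_congr rfl fun j _ => ?_)
        rw [map_smul, smul_eq_mul, abs_mul, Real.mul_rpow (abs_nonneg _) (abs_nonneg _)]
    _ = ∑ j, |a j| ^ p * ∑ i ∈ F, |φ i (molecule ρ o p (x j) (y j))| ^ p := by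
        rw [Finset.sum_comm]
        exact Finset.sum_congr rfl fun j _ => (Finset.mul_sum _ _ _).symm
    _ ≤ ∑ j, |a j| ^ p * K := Finset.sum_le_sum fun j _ =>
        mul_le_mul_of_nonneg_left (h1 j) (Real.rpow_nonneg (abs_nonneg _) p)
    _ = K • ∑ j, |a j| ^ p := by rw [← Finset.sum_mul, mul_comm, smul_eq_mul]

end

end MolSpan

/-! ## The dyadic series -/

/-- A truncated power is dominated by the increments of a bounded function along `u ↦ 2 u`. -/
theorem rpow_neg_mul_min_rpow_le {α p u : ℝ} (h0 : 0 < α) (h1 : α < 1) (hp : 0 < p) (hu : 0 < u) :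
    u ^ (-(p * α)) * (min 1 u) ^ p ≤
      1 / (1 - 2 ^ (p * (α - 1))) * ((min 1 u) ^ (p * (1 - α)) - (min 1 (u / 2)) ^ (p * (1 - α))) +
      1 / (1 - 2 ^ (-(p * α))) * ((max 1 u) ^ (-(p * α)) - (max 1 (2 * u)) ^ (-(p * α))) := by
  have hpα : 0 < p * α := mul_pos hp h0
  have hβ : 0 < p * (1 - α) := mul_pos hp (by linarith)
  have ha : (2 : ℝ) ^ (p * (α - 1)) < 1 :=
    Real.rpow_lt_one_of_one_lt_of_neg one_lt_two (by nlinarith)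
  have hb : (2 : ℝ) ^ (-(p * α)) < 1 := Real.rpow_lt_one_of_one_lt_of_neg one_lt_two (by linarith)
  have hA : 0 < 1 / (1 - (2 : ℝ) ^ (p * (α - 1))) := one_div_pos.2 (by linarith)
  have hB : 0 < 1 / (1 - (2 : ℝ) ^ (-(p * α))) := one_div_pos.2 (by linarith)
  have hg1 : 0 ≤ (min 1 u) ^ (p * (1 - α)) - (min 1 (u / 2)) ^ (p * (1 - α)) :=
    sub_nonneg.2 (Real.rpow_le_rpow (le_min zero_le_one (by linarith))
      (min_le_min le_rfl (by linarith)) hβ.le)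
  have hg2 : 0 ≤ (max 1 u) ^ (-(p * α)) - (max 1 (2 * u)) ^ (-(p * α)) :=
    sub_nonneg.2 (Real.rpow_le_rpow_of_nonpos (lt_max_of_lt_left one_pos)
      (max_le_max le_rfl (by linarith)) (by linarith))
  rcases le_or_gt u 1 with h | h
  · have e : u ^ (-(p * α)) * (min 1 u) ^ p = 1 / (1 - 2 ^ (p * (α - 1))) *
        ((min 1 u) ^ (p * (1 - α)) - (min 1 (u / 2)) ^ (p * (1 - α))) := by
      rw [min_eq_right h, min_eq_right (by linarith), ← Real.rpow_add hu,
        Real.div_rpow hu.le zero_le_two, div_eq_mul_inv (u ^ (p * (1 - α))), ← Real.rpow_neg zero_le_two]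
      have e1 : -(p * α) + p = p * (1 - α) := by ring
      have e2 : -(p * (1 - α)) = p * (α - 1) := by ring
      rw [e1, e2]
      have : 1 - (2 : ℝ) ^ (p * (α - 1)) ≠ 0 := by linarith
      field_simp
    rw [e]
    exact le_add_of_nonneg_right (mul_nonneg hB.le hg2)
  · have e : u ^ (-(p * α)) * (min 1 u) ^ p = 1 / (1 - 2 ^ (-(p * α))) *
        ((max 1 u) ^ (-(p * α)) - (max 1 (2 * u)) ^ (-(p * α))) := by
      rw [min_eq_left h.le, max_eq_right h.le, max_eq_right (by linarith), Real.one_rpow,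
        Real.mul_rpow zero_le_two hu.le]
      have : 1 - (2 : ℝ) ^ (-(p * α)) ≠ 0 := by linarith
      field_simp
    rw [e]
    exact le_add_of_nonneg_left (mul_nonneg hA.le hg1)

theorem sum_dyadic_min_rpow_le {α p t : ℝ} (h0 : 0 < α) (h1 : α < 1) (hp : 0 < p) (ht : 0 < t)
    (n : ℕ) :
    ∑ k ∈ Finset.range n, ((2 : ℝ) ^ (-((k : ℝ) * α))) ^ p * (min 1 (2 ^ k * t)) ^ p
      ≤ (1 / (1 - 2 ^ (p * (α - 1))) + 1 / (1 - 2 ^ (-(p * α)))) * (t ^ α) ^ p := by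
  have hpα : 0 < p * α := mul_pos hp h0
  have ha : (2 : ℝ) ^ (p * (α - 1)) < 1 :=
    Real.rpow_lt_one_of_one_lt_of_neg one_lt_two (by nlinarith)
  have hb : (2 : ℝ) ^ (-(p * α)) < 1 := Real.rpow_lt_one_of_one_lt_of_neg one_lt_two (by linarith)
  set A := 1 / (1 - (2 : ℝ) ^ (p * (α - 1))) with hAdef
  set B := 1 / (1 - (2 : ℝ) ^ (-(p * α))) with hBdef
  have hA : 0 < A := one_div_pos.2 (by linarith)
  have hB : 0 < B := one_div_pos.2 (by linarith)
  set g : ℕ → ℝ := fun k => A * (min 1 (2 ^ k * t / 2)) ^ (p * (1 - α)) with hg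
  set f : ℕ → ℝ := fun k => -(B * (max 1 (2 ^ k * t)) ^ (-(p * α))) with hf
  have hterm : ∀ k : ℕ, ((2 : ℝ) ^ (-((k : ℝ) * α))) ^ p * (min 1 (2 ^ k * t)) ^ p
      ≤ (t ^ α) ^ p * ((g (k + 1) - g k) + (f (k + 1) - f k)) := fun k => by
    have hu : 0 < 2 ^ k * t := by positivity
    have e : ((2 : ℝ) ^ (-((k : ℝ) * α))) ^ p = (t ^ α) ^ p * (2 ^ k * t) ^ (-(p * α)) := by
      rw [Real.mul_rpow (by positivity) ht.le, ← Real.rpow_natCast 2 k, ← Real.rpow_mul zero_le_two,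
        ← Real.rpow_mul zero_le_two, ← Real.rpow_mul ht.le, mul_left_comm, ← Real.rpow_add ht]
      have e1 : α * p + -(p * α) = 0 := by ring
      have e2 : -((k : ℝ) * α) * p = k * -(p * α) := by ring
      rw [e1, e2, Real.rpow_zero, mul_one]
    rw [e, mul_assoc]
    refine mul_le_mul_of_nonneg_left ?_ (Real.rpow_nonneg (Real.rpow_nonneg ht.le _) _)
    refine (rpow_neg_mul_min_rpow_le h0 h1 hp hu).trans_eq ?_
    have e1 : (2 : ℝ) ^ (k + 1) * t = 2 * (2 ^ k * t) := by ring
    simp only [hg, hf]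
    rw [e1, mul_div_cancel_left₀ _ two_ne_zero]
    ring
  refine (Finset.sum_le_sum fun k _ => hterm k).trans ?_
  rw [← Finset.mul_sum, Finset.sum_add_distrib, Finset.sum_range_sub, Finset.sum_range_sub, mul_comm]
  refine mul_le_mul_of_nonneg_right ?_ (Real.rpow_nonneg (Real.rpow_nonneg ht.le _) _)
  have hg0 : 0 ≤ g 0 := mul_nonneg hA.le (Real.rpow_nonneg (le_min zero_le_one (by positivity)) _)
  have hgn : g n ≤ A := mul_le_of_le_one_right hA.le (Real.rpow_le_one
    (le_min zero_le_one (by positivity)) (min_le_left _ _) (mul_nonneg hp.le (by linarith)))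
  have hfn : f n ≤ 0 := neg_nonpos.2 (mul_nonneg hB.le
    (Real.rpow_nonneg (zero_le_one.trans (le_max_left _ _)) _))
  have hf0 : -B ≤ f 0 := neg_le_neg (mul_le_of_le_one_right hB.le
    (Real.rpow_le_one_of_one_le_of_nonpos (le_max_left _ _) (by linarith)))
  linarith

/-! ## The constants -/

theorem two_le_one_div_one_sub_two_rpow {s : ℝ} (h0 : 0 < s) (h1 : s ≤ 1) :
    2 ≤ 1 / (1 - (2 : ℝ) ^ (-s)) := by
  have h : (2 : ℝ) ^ (-s) < 1 := Real.rpow_lt_one_of_one_lt_of_neg one_lt_two (by linarith)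
  have h' : (2 : ℝ) ^ (-1 : ℝ) ≤ 2 ^ (-s) :=
    Real.rpow_le_rpow_of_exponent_le one_le_two (by linarith)
  rw [Real.rpow_neg_one] at h'
  rw [le_div_iff₀ (by linarith)]
  linarith

theorem one_le_constC {p : ℝ} (hp0 : 0 < p) (hp1 : p ≤ 1) {n : ℕ} (hn : 1 ≤ n) :
    1 ≤ constC p n :=
  Real.one_le_rpow (by exact_mod_cast hn) (by rw [sub_nonneg]; exact (one_le_div hp0).2 hp1)

theorem two_le_constRho_rpow {α p : ℝ} (h0 : 0 < α) (h1 : α < 1) (hp0 : 0 < p) (hp1 : p ≤ 1) :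
    0 ≤ constRho α p ∧ 2 ≤ constRho α p ^ p := by
  have hC : 1 ≤ constC p 2 ^ p := Real.one_le_rpow (one_le_constC hp0 hp1 one_le_two) hp0.le
  have hB := two_le_one_div_one_sub_two_rpow (mul_pos hp0 h0) (by nlinarith : p * α ≤ 1)
  have hb : (2 : ℝ) ^ (-(p * α)) < 1 :=
    Real.rpow_lt_one_of_one_lt_of_neg one_lt_two (by nlinarith [mul_pos hp0 h0])
  have e : (2 : ℝ) ^ (-(p * α)) * (1 / (1 - 2 ^ (-(p * α)))) = 1 / (1 - 2 ^ (-(p * α))) - 1 := by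
    have : 1 - (2 : ℝ) ^ (-(p * α)) ≠ 0 := by linarith
    field_simp; ring
  have hq : 0 ≤ (2 : ℝ) ^ (1 - p) := by positivity
  have h2 : 2 ≤ constC p 2 ^ p + (1 + 2 ^ (1 - p)) * 2 ^ (-(p * α)) *
      (1 / (1 - 2 ^ (-(p * α)))) := by
    rw [mul_assoc, e]
    nlinarith
  refine ⟨Real.rpow_nonneg (by linarith) _, ?_⟩
  rw [constRho, ← Real.rpow_mul (by linarith), one_div_mul_cancel hp0.ne', Real.rpow_one]
  exact h2

theorem le_constTau_rpow {d : ℕ} (hd : 1 ≤ d) {α p : ℝ} (h0 : 0 < α) (h1 : α < 1) (hp0 : 0 < p)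
    (hp1 : p ≤ 1) : 0 ≤ constTau d α p ∧
    4 * (1 / (1 - 2 ^ (p * (α - 1)))) * (1 / (1 - 2 ^ (-(p * α)))) * d ≤ constTau d α p ^ p := by
  have hpα : 0 < p * α := mul_pos hp0 h0
  have hd1 : (1 : ℝ) ≤ d := by exact_mod_cast hd
  have hd0 : (0 : ℝ) < d := by linarith
  have hA := two_le_one_div_one_sub_two_rpow (mul_pos hp0 (sub_pos.2 h1))
    (by nlinarith : p * (1 - α) ≤ 1)
  rw [show -(p * (1 - α)) = p * (α - 1) by ring] at hA
  have hB := two_le_one_div_one_sub_two_rpow hpα (by nlinarith : p * α ≤ 1)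
  unfold constTau
  set A := 1 / (1 - (2 : ℝ) ^ (p * (α - 1)))
  set B := 1 / (1 - (2 : ℝ) ^ (-(p * α)))
  have hA0 : 0 ≤ A := by linarith
  have hB0 : 0 ≤ B := by linarith
  have hS : 0 ≤ 1 + ((d : ℝ) - 1) ^ (p * α) :=
    add_nonneg zero_le_one (Real.rpow_nonneg (by linarith) _)
  have hC : 0 ≤ constC (p * α) d := Real.rpow_nonneg hd0.le _
  have hroot : ∀ z : ℝ, 0 ≤ z → (z ^ (1 / p)) ^ p = z := fun z hz => by
    rw [← Real.rpow_mul hz, one_div_mul_cancel hp0.ne', Real.rpow_one]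
  have eC : (constC (p * α) d ^ α) ^ p = (d : ℝ) ^ (1 - p * α) := by
    rw [constC, ← Real.rpow_mul hd0.le, ← Real.rpow_mul hd0.le]
    congr 1
    field_simp
  have e2 : ((2 : ℝ) ^ (2 / p)) ^ p = 4 := by
    rw [← Real.rpow_mul zero_le_two, div_mul_cancel₀ _ hp0.ne']
    norm_num
  have hdS : (d : ℝ) ≤ d ^ (1 - p * α) * (1 + ((d : ℝ) - 1) ^ (p * α)) := by
    have h : (d : ℝ) ^ (p * α) ≤ 1 + ((d : ℝ) - 1) ^ (p * α) := by
      have := Real.rpow_add_le_add_rpow zero_le_one (sub_nonneg.2 hd1) hpα.le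
        (by nlinarith : p * α ≤ 1)
      rwa [add_sub_cancel, Real.one_rpow] at this
    calc (d : ℝ) = d ^ (1 - p * α) * d ^ (p * α) := by
          rw [← Real.rpow_add hd0, sub_add_cancel, Real.rpow_one]
      _ ≤ _ := mul_le_mul_of_nonneg_left h (Real.rpow_nonneg hd0.le _)
  refine ⟨by positivity, ?_⟩
  rw [Real.mul_rpow (by positivity) (by positivity), Real.mul_rpow (by positivity) (by positivity),
    Real.mul_rpow (by positivity) (by positivity), Real.mul_rpow (by positivity) (by positivity),
    hroot _ hA0, hroot _ hB0, hroot _ hS, eC, e2]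
  calc 4 * A * B * d ≤ 4 * A * B * (d ^ (1 - p * α) * (1 + ((d : ℝ) - 1) ^ (p * α))) :=
        mul_le_mul_of_nonneg_left hdS (by positivity)
    _ = _ := by ring

theorem const_product_le {d : ℕ} (hd : 1 ≤ d) {α p : ℝ} (h0 : 0 < α) (h1 : α < 1) (hp0 : 0 < p)
    (hp1 : p ≤ 1) :
    (2 ^ d * ((d : ℝ) ^ α) ^ p) ^ (1 / p) *
      (2 ^ (d + 1) * (1 / (1 - 2 ^ (p * (α - 1))) + 1 / (1 - 2 ^ (-(p * α))))) ^ (1 / p)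
      ≤ constC p (2 ^ d) * constRho α p ^ d * constTau d α p ^ d := by
  obtain ⟨hρ0, hρ⟩ := two_le_constRho_rpow h0 h1 hp0 hp1
  obtain ⟨hτ0, hτ⟩ := le_constTau_rpow hd h0 h1 hp0 hp1
  have hA := two_le_one_div_one_sub_two_rpow (mul_pos hp0 (sub_pos.2 h1))
    (by nlinarith : p * (1 - α) ≤ 1)
  rw [show -(p * (1 - α)) = p * (α - 1) by ring] at hA
  have hB := two_le_one_div_one_sub_two_rpow (mul_pos hp0 h0) (by nlinarith : p * α ≤ 1)
  set A := 1 / (1 - (2 : ℝ) ^ (p * (α - 1)))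
  set B := 1 / (1 - (2 : ℝ) ^ (-(p * α)))
  set R := constRho α p
  set W := constTau d α p
  have hd1 : (1 : ℝ) ≤ d := by exact_mod_cast hd
  have hdα : ((d : ℝ) ^ α) ^ p ≤ d := by
    rw [← Real.rpow_mul (by linarith)]
    exact Real.rpow_le_self_of_one_le hd1 (by nlinarith)
  have hAB1 : A + B ≤ A * B := by nlinarith
  have hAB : 1 ≤ A * B := by nlinarith
  have hRW : 8 * (A * B) * d ≤ R ^ p * W ^ p := by
    calc 8 * (A * B) * d = 2 * (4 * A * B * d) := by ring
      _ ≤ _ := mul_le_mul hρ hτ (by positivity) (by positivity)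
  have key : 2 ^ d * ((d : ℝ) ^ α) ^ p * (2 ^ (d + 1) * (A + B)) ≤ ((R * W) ^ d) ^ p := by
    rw [← Real.rpow_natCast (R * W) d, ← Real.rpow_mul (mul_nonneg hρ0 hτ0), mul_comm (d : ℝ) p,
      Real.rpow_mul (mul_nonneg hρ0 hτ0), Real.rpow_natCast, Real.mul_rpow hρ0 hτ0]
    have h8 : (2 : ℝ) ^ d * 2 ^ (d + 1) ≤ 8 ^ d := by
      have e : (2 : ℝ) ^ d * 2 ^ (d + 1) = 4 ^ d * 2 := by
        rw [pow_succ, ← mul_assoc, ← mul_pow]; norm_num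
      have e' : (8 : ℝ) ^ d = 4 ^ d * 2 ^ d := by rw [← mul_pow]; norm_num
      rw [e, e']
      exact mul_le_mul_of_nonneg_left (le_self_pow₀ one_le_two (by omega)) (by positivity)
    calc 2 ^ d * ((d : ℝ) ^ α) ^ p * (2 ^ (d + 1) * (A + B))
        = 2 ^ d * 2 ^ (d + 1) * (A + B) * ((d : ℝ) ^ α) ^ p := by ring
      _ ≤ 8 ^ d * (A * B) * d := by gcongr
      _ ≤ 8 ^ d * (A * B) ^ d * d ^ d := by
          gcongr
          · exact le_self_pow₀ hAB (by omega)
          · exact le_self_pow₀ hd1 (by omega)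
      _ = (8 * (A * B) * d) ^ d := by rw [mul_pow (8 * (A * B)), mul_pow 8]
      _ ≤ (R ^ p * W ^ p) ^ d := pow_le_pow_left₀ (by positivity) hRW d
  have hRWd : 0 ≤ (R * W) ^ d := pow_nonneg (mul_nonneg hρ0 hτ0) d
  have hC1 : 1 ≤ constC p (2 ^ d) := one_le_constC hp0 hp1 Nat.one_le_two_pow
  calc (2 ^ d * ((d : ℝ) ^ α) ^ p) ^ (1 / p) * (2 ^ (d + 1) * (A + B)) ^ (1 / p)
      = (2 ^ d * ((d : ℝ) ^ α) ^ p * (2 ^ (d + 1) * (A + B))) ^ (1 / p) :=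
        (Real.mul_rpow (by positivity) (by positivity)).symm
    _ ≤ (((R * W) ^ d) ^ p) ^ (1 / p) :=
        Real.rpow_le_rpow (by positivity) key (by positivity)
    _ = (R * W) ^ d := by
        rw [← Real.rpow_mul hRWd, mul_one_div_cancel hp0.ne', Real.rpow_one]
    _ ≤ constC p (2 ^ d) * (R * W) ^ d := le_mul_of_one_le_left hRWd hC1
    _ = _ := by rw [mul_pow, mul_assoc]


/-! ## The hat basis -/

section Hat

variable {d : ℕ}

/-- The hat element of `𝒫([0, 1]^d)`, whose image in the completion is `hatElement`. -/
def molHat (ρ : MetricSpace (UnitCube d)) (α p : ℝ) :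
    ℕ → UnitCube d → MolSpan ρ (0 : UnitCube d) p
  | 0, v => MolSpan.delta ρ 0 p v
  | k + 1, v => (2 : ℝ) ^ (((k + 1 : ℕ) : ℝ) * α) • (MolSpan.delta ρ 0 p v -
      ∑ j : Fin d → Fin (2 ^ k + 1),
        hatCoeff ((2 : ℝ) ^ k)⁻¹ (gridPoint k j) v • MolSpan.delta ρ 0 p (gridPoint k j))

theorem coe_molHat (ρ : MetricSpace (UnitCube d)) (α p : ℝ) (k : ℕ) (v : UnitCube d) :
    ((molHat ρ α p k v : MolSpan ρ 0 p) : UniformSpace.Completion (MolSpan ρ 0 p)) =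
      hatElement ρ α p k v := by
  cases k with
  | zero => rfl
  | succ k =>
    rw [molHat, UniformSpace.Completion.coe_smul, UniformSpace.Completion.coe_sub]
    have h := map_sum (UniformSpace.Completion.toCompl (α := MolSpan ρ (0 : UnitCube d) p))
      (fun j : Fin d → Fin (2 ^ k + 1) =>
        hatCoeff ((2 : ℝ) ^ k)⁻¹ (gridPoint k j) v • MolSpan.delta ρ 0 p (gridPoint k j)) Finset.univ
    rw [UniformSpace.Completion.toCompl_apply] at h
    rw [h]
    simp only [UniformSpace.Completion.toCompl_apply, UniformSpace.Completion.coe_smul]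
    rfl

theorem molHat_succ (ρ : MetricSpace (UnitCube d)) (α p : ℝ) (k : ℕ) (v : UnitCube d) :
    molHat ρ α p (k + 1) v = (2 : ℝ) ^ (((k + 1 : ℕ) : ℝ) * α) •
      ∑ j : Fin d → Fin (2 ^ k + 1), hatCoeff ((2 : ℝ) ^ k)⁻¹ (gridPoint k j) v •
        (MolSpan.delta ρ 0 p v - MolSpan.delta ρ 0 p (gridPoint k j)) := by
  simp_rw [smul_sub]
  rw [Finset.sum_sub_distrib, ← Finset.sum_smul, sum_hatCoeff, one_smul, molHat, smul_sub]

theorem l1Norm_sub_le (x y : UnitCube d) {r : ℝ} (h : ∀ i, |(x i : ℝ) - y i| ≤ r) :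
    l1Norm d (x.toVec - y.toVec) ≤ d * r := by
  rw [l1Norm_apply]
  refine (Finset.sum_le_card_nsmul _ _ r fun i _ => h i).trans_eq ?_
  simp

theorem abs_sub_gridPoint_le {k : ℕ} {v : UnitCube d} (hv : v ∈ grid d (k + 1))
    {j : Fin d → Fin (2 ^ k + 1)} (h : hatCoeff ((2 : ℝ) ^ k)⁻¹ (gridPoint k j) v ≠ 0) (i : Fin d) :
    |(v i : ℝ) - gridPoint k j i| ≤ (2 ^ (k + 1))⁻¹ := by
  rw [hatCoeff_gridPoint, Finset.prod_ne_zero_iff] at h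
  have h' := abs_lt_one_of_tent_ne_zero (h i (Finset.mem_univ i))
  obtain ⟨a, ha⟩ : ∃ a : ℤ, (v i : ℝ) = a / 2 ^ (k + 1) := by
    obtain ⟨l, rfl⟩ := hv
    exact ⟨((l i : ℕ) : ℤ), by rw [gridPoint_apply, Int.cast_natCast]⟩
  obtain ⟨b, hb⟩ : ∃ b : ℤ, ((j i : ℕ) : ℝ) = b := ⟨((j i : ℕ) : ℤ), by rw [Int.cast_natCast]⟩
  rw [gridPoint_apply, ha, hb]
  rw [ha, hb] at h'
  have e : (2 : ℝ) ^ k * (a / 2 ^ (k + 1)) - b = ((a - 2 * b : ℤ) : ℝ) / 2 := by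
    push_cast
    rw [pow_succ]; field_simp
  have e' : (a : ℝ) / 2 ^ (k + 1) - b / 2 ^ k = ((a - 2 * b : ℤ) : ℝ) * (2 ^ (k + 1))⁻¹ := by
    push_cast
    rw [pow_succ]; field_simp
  rw [e, abs_div, abs_two, div_lt_one two_pos, ← Int.cast_abs] at h'
  have h2 : |a - 2 * b| < 2 := by exact_mod_cast h'
  rw [e', abs_mul, abs_of_pos (by positivity : (0 : ℝ) < (2 ^ (k + 1))⁻¹), ← Int.cast_abs]
  refine mul_le_of_le_one_left (by positivity) ?_
  exact_mod_cast Int.lt_add_one_iff.1 h2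

/-- The level `k` of a dyadic point `v ∈ V_k \ V_{k-1}`. -/
def level (v : dyadicPoints d) : ℕ := (Set.mem_iUnion.1 v.2).choose

theorem mem_newPoints_level (v : dyadicPoints d) : (v : UnitCube d) ∈ newPoints d (level v) :=
  (Set.mem_iUnion.1 v.2).choose_spec

theorem level_eq {v : dyadicPoints d} {k : ℕ} (h : (v : UnitCube d) ∈ newPoints d k) :
    level v = k := newPoints_level_unique (mem_newPoints_level v) h

theorem hatCoeff_level_zero (v : dyadicPoints d) :
    hatCoeff ((2 : ℝ) ^ level v)⁻¹ v (0 : UnitCube d) = 0 :=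
  hatCoeff_of_mem_grid (newPoints_subset_grid _ (mem_newPoints_level v)) (zero_mem_grid _)
    (ne_zero_of_mem_newPoints (mem_newPoints_level v))

/-- The coordinate functional of the hat basis at the dyadic point `v`. -/
def hatCoord (ρ : MetricSpace (UnitCube d)) (α p : ℝ) (v : dyadicPoints d) :
    MolSpan ρ (0 : UnitCube d) p →ₗ[ℝ] ℝ :=
  MolSpan.lift (fun x => (2 : ℝ) ^ (-((level v : ℝ) * α)) * hatCoeff ((2 : ℝ) ^ level v)⁻¹ v x)
    (by rw [hatCoeff_level_zero, mul_zero])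

theorem hatCoord_delta (ρ : MetricSpace (UnitCube d)) (α p : ℝ) (v : dyadicPoints d)
    (x : UnitCube d) : hatCoord ρ α p v (MolSpan.delta ρ 0 p x) =
      (2 : ℝ) ^ (-((level v : ℝ) * α)) * hatCoeff ((2 : ℝ) ^ level v)⁻¹ v x :=
  MolSpan.lift_delta _ _ x

theorem hatCoord_molHat_succ (ρ : MetricSpace (UnitCube d)) (α p : ℝ) (v : dyadicPoints d) (k : ℕ)
    (w : UnitCube d) : hatCoord ρ α p v (molHat ρ α p (k + 1) w) =
      (2 : ℝ) ^ (((k + 1 : ℕ) : ℝ) * α) * ((2 : ℝ) ^ (-((level v : ℝ) * α)) *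
        (hatCoeff ((2 : ℝ) ^ level v)⁻¹ v w - ∑ j : Fin d → Fin (2 ^ k + 1),
          hatCoeff ((2 : ℝ) ^ k)⁻¹ (gridPoint k j) w *
            hatCoeff ((2 : ℝ) ^ level v)⁻¹ v (gridPoint k j))) := by
  rw [molHat, map_smul, map_sub, map_sum, smul_eq_mul, hatCoord_delta, mul_sub (2 ^ (-_)),
    Finset.mul_sum]
  congr 2
  refine Finset.sum_congr rfl fun j _ => ?_
  rw [map_smul, smul_eq_mul, hatCoord_delta]
  ring

theorem hatCoord_molHat_self (ρ : MetricSpace (UnitCube d)) (α p : ℝ) (v : dyadicPoints d) :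
    hatCoord ρ α p v (molHat ρ α p (level v) v) = 1 := by
  have hv := mem_newPoints_level v
  have h1 := hatCoeff_self (newPoints_subset_grid _ hv)
  rcases hk : level v with _ | k
  · rw [molHat, hatCoord_delta, h1, hk]
    simp
  · rw [hk] at hv h1
    rw [hatCoord_molHat_succ, hk, h1, Finset.sum_eq_zero, sub_zero, mul_one, ← Real.rpow_add two_pos,
      add_neg_cancel, Real.rpow_zero]
    intro j _
    rw [hatCoeff_of_mem_grid (newPoints_subset_grid _ hv) (grid_subset_succ k ⟨j, rfl⟩)
      (fun e => hv.2 ⟨j, e.symm⟩), mul_zero]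

theorem hatCoord_molHat_of_ne (ρ : MetricSpace (UnitCube d)) (α p : ℝ) {v w : dyadicPoints d}
    (h : v ≠ w) : hatCoord ρ α p v (molHat ρ α p (level w) w) = 0 := by
  have hv := mem_newPoints_level v
  have hw := mem_newPoints_level w
  have hvg := newPoints_subset_grid _ hv
  have hwg := newPoints_subset_grid _ hw
  have hne : (v : UnitCube d) ≠ w := fun e => h (Subtype.ext e)
  rcases hk : level w with _ | k
  · rw [hk] at hwg
    rw [molHat, hatCoord_delta, hatCoeff_of_mem_grid hvg (grid_mono (Nat.zero_le _) hwg) hne,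
      mul_zero]
  · rw [hk] at hwg
    rw [hatCoord_molHat_succ]
    rcases le_or_gt (level v) k with hl | hl
    · rw [sum_hatCoeff_mul_hatCoeff hl hvg, sub_self, mul_zero, mul_zero]
    · rw [hatCoeff_of_mem_grid hvg (grid_mono hl hwg) hne, Finset.sum_eq_zero, sub_zero, mul_zero,
        mul_zero]
      intro j _
      rw [hatCoeff_of_mem_grid hvg (grid_mono hl.le ⟨j, rfl⟩)
        (fun e => notMem_grid_of_lt hv hl (e ▸ ⟨j, rfl⟩)), mul_zero]

theorem sum_level_le {k : ℕ} (F : Finset (dyadicPoints d)) (W : UnitCube d → ℝ)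
    (hW : ∀ u, 0 ≤ W u) :
    ∑ v ∈ F with level v = k, W v ≤ ∑ j : Fin d → Fin (2 ^ k + 1), W (gridPoint k j) := by
  classical
  rw [← Finset.sum_image (g := fun v : dyadicPoints d => (v : UnitCube d)) (f := W)
    Subtype.val_injective.injOn, ← Finset.sum_image (f := W) (gridPoint_injective k).injOn]
  refine Finset.sum_le_sum_of_subset_of_nonneg ?_ fun u _ _ => hW u
  intro u hu
  obtain ⟨v, hv, rfl⟩ := Finset.mem_image.1 hu
  have hvk := mem_newPoints_level v
  rw [(Finset.mem_filter.1 hv).2] at hvk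
  obtain ⟨j, hj⟩ := newPoints_subset_grid _ hvk
  exact Finset.mem_image.2 ⟨j, Finset.mem_univ _, hj⟩

theorem sum_hatCoord_sub_le (ρ : MetricSpace (UnitCube d)) {α p : ℝ} (h0 : 0 < α) (h1 : α < 1)
    (hp : 0 < p) (F : Finset (dyadicPoints d)) (x y : UnitCube d) :
    ∑ v ∈ F, |hatCoord ρ α p v (MolSpan.delta ρ 0 p x) -
      hatCoord ρ α p v (MolSpan.delta ρ 0 p y)| ^ p ≤
      2 ^ (d + 1) * (1 / (1 - 2 ^ (p * (α - 1))) + 1 / (1 - 2 ^ (-(p * α)))) *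
        (l1Norm d (x.toVec - y.toVec) ^ α) ^ p := by
  rcases eq_or_ne x y with rfl | hxy
  · simp [Real.zero_rpow hp.ne', Real.zero_rpow h0.ne']
  have ht : 0 < l1Norm d (x.toVec - y.toVec) := by
    refine lt_of_le_of_ne (apply_nonneg _ _) fun e => hxy ?_
    have h := sub_eq_zero.1 (l1Norm_definite _ e.symm)
    exact funext fun i => Subtype.ext (congrFun h i)
  set W : ℕ → UnitCube d → ℝ := fun k u => ((2 : ℝ) ^ (-((k : ℝ) * α))) ^ p *
    |hatCoeff ((2 : ℝ) ^ k)⁻¹ u x - hatCoeff ((2 : ℝ) ^ k)⁻¹ u y| ^ p with hWdef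
  have hW : ∀ k u, 0 ≤ W k u := fun k u => by positivity
  have hterm : ∀ v : dyadicPoints d, |hatCoord ρ α p v (MolSpan.delta ρ 0 p x) -
      hatCoord ρ α p v (MolSpan.delta ρ 0 p y)| ^ p = W (level v) v := fun v => by
    rw [hatCoord_delta, hatCoord_delta, ← mul_sub, abs_mul,
      Real.mul_rpow (abs_nonneg _) (abs_nonneg _), abs_of_nonneg (by positivity)]
  obtain ⟨n, hn⟩ : ∃ n, ∀ v ∈ F, level v ∈ Finset.range n :=
    ⟨F.sup level + 1, fun v hv => Finset.mem_range.2 (Nat.lt_succ_iff.2 (Finset.le_sup hv))⟩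
  calc ∑ v ∈ F, |hatCoord ρ α p v (MolSpan.delta ρ 0 p x) -
        hatCoord ρ α p v (MolSpan.delta ρ 0 p y)| ^ p
      = ∑ k ∈ Finset.range n, ∑ v ∈ F with level v = k, W (level v) v := by
        simp_rw [hterm]
        exact (Finset.sum_fiberwise_of_maps_to hn _).symm
    _ = ∑ k ∈ Finset.range n, ∑ v ∈ F with level v = k, W k v :=
        Finset.sum_congr rfl fun k _ => Finset.sum_congr rfl fun v hv => by
          rw [(Finset.mem_filter.1 hv).2]
    _ ≤ ∑ k ∈ Finset.range n, 2 ^ (d + 1) * (((2 : ℝ) ^ (-((k : ℝ) * α))) ^ p *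
          (min 1 (2 ^ k * l1Norm d (x.toVec - y.toVec))) ^ p) := by
        refine Finset.sum_le_sum fun k _ => (sum_level_le F (W k) (hW k)).trans ?_
        rw [← Finset.mul_sum, mul_left_comm]
        exact mul_le_mul_of_nonneg_left (sum_hatCoeff_sub_rpow_le k x y hp) (by positivity)
    _ ≤ _ := by
        rw [← Finset.mul_sum, mul_assoc]
        exact mul_le_mul_of_nonneg_left (sum_dyadic_min_rpow_le h0 h1 hp ht n) (by positivity)

end Hat

/-! ## Norms equivalent to the `ℓ_1` norm -/

section Cube

variable {d : ℕ} (N : Seminorm ℝ (Fin d → ℝ)) (hN : ∀ x, N x = 0 → x = 0) {α : ℝ} (h0 : 0 < α)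
  (h1 : α < 1)

theorem exists_equivalence_constants {d : ℕ} (N : Seminorm ℝ (Fin d → ℝ))
    (hN : ∀ x, N x = 0 → x = 0) : ∃ K₁ K₂ : ℝ, 0 ≤ K₁ ∧ 0 ≤ K₂ ∧ (∀ x, N x ≤ K₁ * l1Norm d x) ∧
      ∀ x, l1Norm d x ≤ K₂ * N x := by
  have hup : ∀ x, N x ≤ (∑ i, N (Pi.single i 1)) * l1Norm d x := fun x => by
    have e : x = ∑ i, x i • (Pi.single i 1 : Fin d → ℝ) := by
      simpa using (pi_eq_sum_univ' x)
    calc N x ≤ ∑ i, N (x i • (Pi.single i 1 : Fin d → ℝ)) := by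
          conv_lhs => rw [e]
          exact Finset.le_sum_of_subadditive N (map_zero N).le (map_add_le_add N) _ _
      _ = ∑ i, N (Pi.single i 1) * |x i| := Finset.sum_congr rfl fun i _ => by
          rw [map_smul_eq_mul, Real.norm_eq_abs, mul_comm]
      _ ≤ ∑ i, N (Pi.single i 1) * l1Norm d x := Finset.sum_le_sum fun i _ =>
          mul_le_mul_of_nonneg_left (Finset.single_le_sum (f := fun i => |x i|)
            (fun _ _ => abs_nonneg _) (Finset.mem_univ i)) (apply_nonneg _ _)
      _ = _ := by rw [Finset.sum_mul]
  have hK : 0 ≤ ∑ i, N (Pi.single i 1 : Fin d → ℝ) := Finset.sum_nonneg fun _ _ => apply_nonneg _ _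
  have hl1 : Continuous (l1Norm d) := by
    have : (l1Norm d : (Fin d → ℝ) → ℝ) = fun x => ∑ i, |x i| := rfl
    rw [this]; fun_prop
  have hNc : Continuous N := by
    refine Seminorm.continuous_of_continuousAt_zero ?_
    rw [ContinuousAt, map_zero]
    have h := (hl1.const_mul (∑ i, N (Pi.single i 1 : Fin d → ℝ))).tendsto 0
    rw [map_zero, mul_zero] at h
    exact squeeze_zero (fun _ => apply_nonneg _ _) hup h
  set S : Set (Fin d → ℝ) := {x | l1Norm d x = 1} with hS
  have hScomp : IsCompact S := by
    refine Metric.isCompact_of_isClosed_isBounded (isClosed_eq hl1 continuous_const) ?_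
    refine (Metric.isBounded_closedBall (x := (0 : Fin d → ℝ)) (r := 1)).subset fun x hx => ?_
    rw [mem_closedBall_zero_iff, pi_norm_le_iff_of_nonneg zero_le_one]
    intro i
    rw [← (hx : l1Norm d x = 1), Real.norm_eq_abs]
    exact Finset.single_le_sum (f := fun i => |x i|) (fun _ _ => abs_nonneg _) (Finset.mem_univ i)
  obtain ⟨c, hc, hcS⟩ : ∃ c > 0, ∀ x ∈ S, c ≤ N x := by
    rcases S.eq_empty_or_nonempty with hE | hne
    · exact ⟨1, one_pos, fun x hx => by rw [hE] at hx; exact hx.elim⟩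
    · obtain ⟨x, hx, hmin⟩ := hScomp.exists_isMinOn hne hNc.continuousOn
      refine ⟨N x, lt_of_le_of_ne (apply_nonneg _ _) fun e => ?_, fun y hy => hmin hy⟩
      have hx' : l1Norm d x = 1 := hx
      rw [hN x e.symm, map_zero] at hx'
      exact zero_ne_one hx'
  refine ⟨_, c⁻¹, hK, (inv_pos.2 hc).le, hup, fun x => ?_⟩
  rcases (apply_nonneg (l1Norm d) x).eq_or_lt with hx | hx
  · rw [← hx]; exact mul_nonneg (inv_pos.2 hc).le (apply_nonneg _ _)
  · have h := hcS ((l1Norm d x)⁻¹ • x) (by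
      rw [hS, Set.mem_ofPred_eq, map_smul_eq_mul, Real.norm_eq_abs, abs_of_pos (inv_pos.2 hx),
        inv_mul_cancel₀ hx.ne'])
    rw [map_smul_eq_mul, Real.norm_eq_abs, abs_of_pos (inv_pos.2 hx), le_inv_mul_iff₀ hx] at h
    rwa [le_inv_mul_iff₀ hc, mul_comm]

theorem holderMetric_dist (x y : UnitCube d) :
    (holderMetric N hN α h0 h1).dist x y = N (x.toVec - y.toVec) ^ α := rfl

theorem holderMetric_dist_le {K₁ : ℝ} (hK₁ : 0 ≤ K₁) (hup : ∀ x, N x ≤ K₁ * l1Norm d x)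
    (x y : UnitCube d) {r : ℝ} (hr : ∀ i, |(x i : ℝ) - y i| ≤ r) (hr0 : 0 ≤ r) :
    (holderMetric N hN α h0 h1).dist x y ≤ K₁ ^ α * (d : ℝ) ^ α * r ^ α := by
  rw [holderMetric_dist, ← Real.mul_rpow hK₁ (Nat.cast_nonneg d),
    ← Real.mul_rpow (by positivity) hr0, mul_assoc]
  exact Real.rpow_le_rpow (apply_nonneg _ _) ((hup _).trans
    (mul_le_mul_of_nonneg_left (l1Norm_sub_le x y hr) hK₁)) h0.le

theorem norm_molHat_le {p : ℝ} (hp0 : 0 < p) {K₁ : ℝ} (hK₁ : 0 ≤ K₁)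
    (hup : ∀ x, N x ≤ K₁ * l1Norm d x) {k : ℕ} {v : UnitCube d} (hv : v ∈ newPoints d k) :
    ‖molHat (holderMetric N hN α h0 h1) α p k v‖ ≤
      (K₁ ^ α) ^ p * (2 ^ d * ((d : ℝ) ^ α) ^ p) := by
  have hnonneg := @dist_nonneg _ (holderMetric N hN α h0 h1).toPseudoMetricSpace
  cases k with
  | zero =>
    have h := MolSpan.norm_delta_sub_le (ρ := holderMetric N hN α h0 h1) (o := 0) (p := p) v 0
    rw [MolSpan.delta_base, sub_zero] at h
    have h2 := holderMetric_dist_le N hN h0 h1 hK₁ hup v 0 (r := 1) (fun i => by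
      have := (v i).2
      rw [show (((0 : UnitCube d) i : unitInterval) : ℝ) = 0 from rfl, sub_zero, abs_of_nonneg this.1]
      exact this.2) zero_le_one
    rw [Real.one_rpow, mul_one] at h2
    refine h.trans ((Real.rpow_le_rpow hnonneg h2 hp0.le).trans ?_)
    rw [Real.mul_rpow (by positivity) (by positivity)]
    exact mul_le_mul_of_nonneg_left (le_mul_of_one_le_left (by positivity)
      (one_le_pow₀ one_le_two)) (by positivity)
  | succ k =>
    classical
    set c : ℝ := (K₁ ^ α * (d : ℝ) ^ α * ((2 ^ (k + 1))⁻¹) ^ α) ^ p with hc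
    have hc0 : 0 ≤ c := by positivity
    have hterm : ∀ j : Fin d → Fin (2 ^ k + 1),
        ‖hatCoeff ((2 : ℝ) ^ k)⁻¹ (gridPoint k j) v •
          (MolSpan.delta (holderMetric N hN α h0 h1) 0 p v - MolSpan.delta _ 0 p (gridPoint k j))‖
        ≤ if hatCoeff ((2 : ℝ) ^ k)⁻¹ (gridPoint k j) v ≠ 0 then c else 0 := fun j => by
      split_ifs with h
      · refine (MolSpan.norm_smul_le _ _).trans ?_
        refine (mul_le_of_le_one_left (norm_nonneg _) (Real.rpow_le_one (abs_nonneg _) ?_ hp0.le)).trans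
          ?_
        · rw [abs_of_nonneg (hatCoeff_nonneg _ _ _)]
          exact hatCoeff_le_one (by positivity) _ _
        · exact (MolSpan.norm_delta_sub_le _ _).trans (Real.rpow_le_rpow hnonneg
            (holderMetric_dist_le N hN h0 h1 hK₁ hup _ _
              (abs_sub_gridPoint_le (newPoints_subset_grid _ hv) h) (by positivity)) hp0.le)
      · rw [not_not.1 h, zero_smul, norm_zero]
    rw [molHat_succ]
    refine (MolSpan.norm_smul_le _ _).trans ?_
    have hsum := (norm_sum_le _ _).trans (Finset.sum_le_sum fun j (_ : j ∈ Finset.univ) => hterm j)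
    rw [← Finset.sum_filter, Finset.sum_const, nsmul_eq_mul] at hsum
    have hcard : ((Finset.univ.filter fun j : Fin d → Fin (2 ^ k + 1) =>
        hatCoeff ((2 : ℝ) ^ k)⁻¹ (gridPoint k j) v ≠ 0).card : ℝ) ≤ 2 ^ d := by
      exact_mod_cast card_hatCoeff_ne_zero_le k v
    have hsum' := hsum.trans (mul_le_mul_of_nonneg_right hcard hc0)
    refine (mul_le_mul_of_nonneg_left hsum' (by positivity)).trans_eq ?_
    have e1 : |(2 : ℝ) ^ (((k + 1 : ℕ) : ℝ) * α)| * ((2 ^ (k + 1))⁻¹) ^ α = 1 := by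
      rw [abs_of_pos (by positivity), Real.inv_rpow (by positivity), Real.rpow_mul zero_le_two,
        Real.rpow_natCast, mul_inv_cancel₀ (by positivity)]
    have e2 : |(2 : ℝ) ^ (((k + 1 : ℕ) : ℝ) * α)| ^ p * (((2 ^ (k + 1))⁻¹) ^ α) ^ p = 1 := by
      rw [← Real.mul_rpow (abs_nonneg _) (by positivity), e1, Real.one_rpow]
    rw [hc, Real.mul_rpow (by positivity) (by positivity),
      Real.mul_rpow (by positivity) (by positivity)]
    linear_combination ((K₁ ^ α) ^ p * (2 ^ d * ((d : ℝ) ^ α) ^ p)) * e2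

theorem sum_hatCoord_le {p : ℝ} (hp0 : 0 < p) (hp1 : p ≤ 1) {K₂ : ℝ} (hK₂ : 0 ≤ K₂)
    (hlow : ∀ x, l1Norm d x ≤ K₂ * N x) (F : Finset (dyadicPoints d))
    (m : MolSpan (holderMetric N hN α h0 h1) 0 p) :
    ∑ v ∈ F, |hatCoord (holderMetric N hN α h0 h1) α p v m| ^ p ≤
      (K₂ ^ α) ^ p * (2 ^ (d + 1) * (1 / (1 - 2 ^ (p * (α - 1))) + 1 / (1 - 2 ^ (-(p * α))))) *
        ‖m‖ := by
  have ha : (2 : ℝ) ^ (p * (α - 1)) < 1 :=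
    Real.rpow_lt_one_of_one_lt_of_neg one_lt_two (by nlinarith)
  have hb : (2 : ℝ) ^ (-(p * α)) < 1 :=
    Real.rpow_lt_one_of_one_lt_of_neg one_lt_two (by nlinarith [mul_pos hp0 h0])
  have hA : 0 < 1 / (1 - (2 : ℝ) ^ (p * (α - 1))) := one_div_pos.2 (by linarith)
  have hB : 0 < 1 / (1 - (2 : ℝ) ^ (-(p * α))) := one_div_pos.2 (by linarith)
  refine MolSpan.sum_functionals_rpow_le hp0 hp1 _ (by positivity) F (fun x y => ?_) m
  refine (sum_hatCoord_sub_le _ h0 h1 hp0 F x y).trans ?_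
  have h : (l1Norm d (x.toVec - y.toVec) ^ α) ^ p ≤
      (K₂ ^ α) ^ p * (N (x.toVec - y.toVec) ^ α) ^ p := by
    rw [← Real.mul_rpow (by positivity) (Real.rpow_nonneg (apply_nonneg _ _) _),
      ← Real.mul_rpow hK₂ (apply_nonneg _ _)]
    exact Real.rpow_le_rpow (Real.rpow_nonneg (apply_nonneg _ _) _)
      (Real.rpow_le_rpow (apply_nonneg _ _) (hlow _) h0.le) hp0.le
  refine (mul_le_mul_of_nonneg_left h (by positivity)).trans_eq ?_
  rw [holderMetric_dist]; ring

end Cube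


/-! ## The isomorphism -/

section Isomorphism

open UniformSpace Filter Topology

variable {d : ℕ}

/-- A closed subspace of the free `p`-space over the cube that contains the hat elements is
everything. -/
theorem mem_of_hat_mem {ρ : MetricSpace (UnitCube d)} {α p K : ℝ} (h0 : 0 < α) (hp0 : 0 < p)
    (hρ : ∀ (x y : UnitCube d) (r : ℝ), (∀ i, |(x i : ℝ) - y i| ≤ r) → 0 ≤ r →
      ρ.dist x y ≤ K * r ^ α)
    (S : Submodule ℝ (Completion (MolSpan ρ (0 : UnitCube d) p)))
    (hS : IsClosed (S : Set (Completion (MolSpan ρ (0 : UnitCube d) p))))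
    (hmem : ∀ k, ∀ v ∈ newPoints d k, ((molHat ρ α p k v : MolSpan ρ (0 : UnitCube d) p) :
      Completion (MolSpan ρ (0 : UnitCube d) p)) ∈ S)
    (x : Completion (MolSpan ρ (0 : UnitCube d) p)) : x ∈ S := by
  obtain ⟨S', hmem'⟩ : ∃ S' : Submodule ℝ (MolSpan ρ (0 : UnitCube d) p),
      ∀ m, m ∈ S' ↔ (m : Completion (MolSpan ρ (0 : UnitCube d) p)) ∈ S :=
    ⟨{ carrier := {m | (m : Completion (MolSpan ρ (0 : UnitCube d) p)) ∈ S}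
       zero_mem' := S.zero_mem
       add_mem' := fun {a b} ha hb => by
        rw [Set.mem_ofPred_eq, Completion.coe_add]; exact S.add_mem ha hb
       smul_mem' := fun c m hm => by
        rw [Set.mem_ofPred_eq, Completion.coe_smul]; exact S.smul_mem c hm }, fun _ => Iff.rfl⟩
  have hnew : ∀ n k, k ≤ n → ∀ v ∈ newPoints d k, MolSpan.delta ρ 0 p v ∈ S' := by
    intro n
    induction n with
    | zero =>
      intro k hk v hv
      obtain rfl : k = 0 := Nat.le_zero.1 hk
      exact (hmem' _).2 (hmem 0 v hv)
    | succ n ih =>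
      intro k hk v hv
      rcases Nat.le_succ_iff.1 hk with h | rfl
      · exact ih k h v hv
      · have hgrid : ∀ u ∈ grid d n, MolSpan.delta ρ 0 p u ∈ S' := fun u hu => by
          rcases mem_grid_zero_or_newPoints hu with rfl | ⟨l, hl, hl'⟩
          · rw [MolSpan.delta_base]; exact S'.zero_mem
          · exact ih l hl u hl'
        have h := (hmem' _).2 (hmem (n + 1) v hv)
        rw [molHat, S'.smul_mem_iff (by positivity)] at h
        have hsum := S'.sum_mem (t := Finset.univ) fun (j : Fin d → Fin (2 ^ n + 1)) _ =>
          S'.smul_mem (hatCoeff ((2 : ℝ) ^ n)⁻¹ (gridPoint n j) v) (hgrid _ ⟨j, rfl⟩)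
        simpa using S'.add_mem h hsum
  have hdyadic : ∀ k, ∀ v ∈ grid d k, MolSpan.delta ρ 0 p v ∈ S' := fun k v hv => by
    rcases mem_grid_zero_or_newPoints hv with rfl | ⟨l, _, hl⟩
    · rw [MolSpan.delta_base]; exact S'.zero_mem
    · exact hnew l l le_rfl v hl
  have hdelta : ∀ z, MolSpan.delta ρ 0 p z ∈ S' := fun z => by
    set j : ∀ k : ℕ, Fin d → Fin (2 ^ k + 1) := fun k i =>
      ⟨⌊(2 : ℝ) ^ k * (z i : ℝ)⌋₊, Nat.lt_succ_iff.2
        (Nat.floor_le_of_le (scaled_coord_le k z i))⟩ with hj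
    have hclose : ∀ k i, |(gridPoint k (j k) i : ℝ) - z i| ≤ (1 / 2) ^ k := fun k i => by
      have hk : (0 : ℝ) < 2 ^ k := by positivity
      have e1 := Nat.floor_le (scaled_coord_nonneg k z i)
      have e2 := Nat.lt_floor_add_one ((2 : ℝ) ^ k * (z i : ℝ))
      rw [gridPoint_apply, abs_sub_comm, one_div, inv_pow, abs_le]
      have e3 : (z i : ℝ) - (((j k i : Fin (2 ^ k + 1)) : ℕ) : ℝ) / 2 ^ k =
          (2 ^ k * (z i : ℝ) - ⌊(2 : ℝ) ^ k * (z i : ℝ)⌋₊) * (2 ^ k)⁻¹ := by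
        simp only [hj]; field_simp
      rw [e3]
      constructor
      · exact le_trans (neg_nonpos.2 (by positivity)) (mul_nonneg (by linarith) (by positivity))
      · exact mul_le_of_le_one_left (by positivity) (by linarith)
    have hnorm : ∀ k, ‖((MolSpan.delta ρ 0 p (gridPoint k (j k)) : MolSpan ρ 0 p) : Completion _) -
        ((MolSpan.delta ρ 0 p z : MolSpan ρ 0 p) : Completion (MolSpan ρ 0 p))‖ ≤
        (K * ((1 / 2) ^ k) ^ α) ^ p := fun k => by
      rw [← Completion.coe_sub, Completion.norm_coe]
      exact (MolSpan.norm_delta_sub_le _ _).trans (Real.rpow_le_rpow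
        (@dist_nonneg _ ρ.toPseudoMetricSpace _ _)
        (hρ _ _ _ (hclose k) (by positivity)) hp0.le)
    have hlim : Tendsto (fun k : ℕ => (K * ((1 / 2 : ℝ) ^ k) ^ α) ^ p) atTop (𝓝 0) := by
      have h := (((tendsto_pow_atTop_nhds_zero_of_lt_one (r := (1 / 2 : ℝ)) (by norm_num)
        (by norm_num)).rpow_const (p := α) (Or.inr h0.le)).const_mul K).rpow_const (p := p)
          (Or.inr hp0.le)
      rwa [Real.zero_rpow h0.ne', mul_zero, Real.zero_rpow hp0.ne'] at h
    rw [hmem']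
    exact hS.mem_of_tendsto (tendsto_iff_norm_sub_tendsto_zero.2
      (squeeze_zero (fun _ => norm_nonneg _) hnorm hlim))
      (Eventually.of_forall fun k => (hmem' _).1 (hdyadic k _ ⟨j k, rfl⟩))
  induction x using Completion.induction_on with
  | hp => exact hS
  | ih m => exact (hmem' m).1 (MolSpan.mem_of_delta_mem S' hdelta m)

/-- A bounded, complete family in a free `p`-space with an `ℓ_p`-bounded biorthogonal family of
functionals is the image of the unit vector basis of `ℓ_p` under an isomorphism. -/
theorem exists_isomorphism_of_biorthogonal {ι M : Type*} {ρ : MetricSpace M} {o : M} {p : ℝ}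
    (hp0 : 0 < p) {h : ι → MolSpan ρ o p} {φ : ι → MolSpan ρ o p →ₗ[ℝ] ℝ} {C₁ C₂ : ℝ}
    (hC₁ : 0 ≤ C₁) (hC₂ : 0 ≤ C₂) (hh : ∀ i, ‖h i‖ ≤ C₁)
    (hφ : ∀ (F : Finset ι) (m : MolSpan ρ o p), ∑ i ∈ F, |φ i m| ^ p ≤ C₂ * ‖m‖)
    (hself : ∀ i, φ i (h i) = 1) (hne : ∀ i j, i ≠ j → φ i (h j) = 0)
    (hdense : ∀ S : Submodule ℝ (Completion (MolSpan ρ o p)),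
      IsClosed (S : Set (Completion (MolSpan ρ o p))) →
      (∀ i, (h i : Completion (MolSpan ρ o p)) ∈ S) → ∀ x, x ∈ S) :
    ∃ T : Ellp ι p ≃ₗ[ℝ] LipFree ρ o p,
      (∀ i, T (unitVec p i) = (h i : Completion (MolSpan ρ o p))) ∧
      (∀ f, ‖T f‖ ≤ C₁ ^ (1 / p) * ‖f‖) ∧ ∀ x, ‖T.symm x‖ ≤ C₂ ^ (1 / p) * ‖x‖ := by
  have hX := norm_completion_smul_le (E := MolSpan ρ o p) (p := p) MolSpan.norm_smul_le
  have hC : ∀ i, ‖(h i : Completion (MolSpan ρ o p))‖ ≤ C₁ := fun i => by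
    rw [Completion.norm_coe]; exact hh i
  obtain ⟨A, hA⟩ : ∃ A, A = analysis hφ hp0 := ⟨_, rfl⟩
  obtain ⟨T, hT⟩ : ∃ T, T = synthesis hX hC hp0 := ⟨_, rfl⟩
  have hAT : ∀ f, A (T f) = f := fun f => by
    rw [hA, hT]; exact analysis_synthesis hφ hp0 hX hC hself hne f
  have hTle : ∀ f, ‖T f‖ ≤ C₁ * ∑' i, |f i| ^ p := fun f => by
    rw [hT]; exact norm_synthesis_le hX hC hp0 f
  have hAle : ∀ x, ∑' i, |A x i| ^ p ≤ C₂ * ‖x‖ := fun x => by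
    rw [hA]; exact tsum_analysis_le hφ hp0 x
  have hunit : ∀ i, T (unitVec p i) = (h i : Completion (MolSpan ρ o p)) := fun i => by
    rw [hT]; exact synthesis_unitVec hX hC hp0 i
  have hTA : ∀ x, T (A x) = x := by
    have hcont : Continuous (T.comp A) := by
      refine AddMonoidHomClass.continuous_of_bound (T.comp A) (C₁ * C₂) fun x => ?_
      refine (hTle (A x)).trans ?_
      rw [mul_assoc]
      exact mul_le_mul_of_nonneg_left (hAle x) hC₁
    refine hdense (LinearMap.eqLocus (T.comp A) LinearMap.id) (isClosed_eq hcont continuous_id) ?_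
    intro i
    rw [LinearMap.mem_eqLocus, LinearMap.id_apply, LinearMap.comp_apply, ← hunit, hAT]
  refine ⟨LinearEquiv.ofLinearMap (M₂ := Completion (MolSpan ρ o p)) T A
    (LinearMap.ext hTA) (LinearMap.ext hAT), hunit, fun f => ?_, fun x => ?_⟩
  · rw [Ellp.norm_eq hp0, ← Real.mul_rpow hC₁ (tsum_nonneg fun _ => by positivity)]
    exact Real.rpow_le_rpow (norm_nonneg (E := Completion (MolSpan ρ o p)) _) (hTle f)
      (by positivity)
  · refine (Ellp.norm_eq hp0 _).trans_le ?_
    refine (Real.rpow_le_rpow (tsum_nonneg fun _ => by positivity) (hAle x)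
      (by positivity)).trans_eq ?_
    exact Real.mul_rpow hC₂ (norm_nonneg (E := Completion (MolSpan ρ o p)) x)

/-- The hat basis isomorphism, with explicit bounds, for a norm equivalent to the `ℓ_1` norm. -/
theorem exists_hat_isomorphism (N : Seminorm ℝ (Fin d → ℝ)) (hN : ∀ x, N x = 0 → x = 0) {α : ℝ}
    (h0 : 0 < α) (h1 : α < 1) {p : ℝ} (hp0 : 0 < p) (hp1 : p ≤ 1) {K₁ K₂ : ℝ} (hK₁ : 0 ≤ K₁)
    (hK₂ : 0 ≤ K₂) (hup : ∀ x, N x ≤ K₁ * l1Norm d x) (hlow : ∀ x, l1Norm d x ≤ K₂ * N x) :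
    ∃ T : Ellp (dyadicPoints d) p ≃ₗ[ℝ] CubeFree N hN α h0 h1 p,
      (∀ (k : ℕ) (v : dyadicPoints d), (v : UnitCube d) ∈ newPoints d k →
        T (unitVec p v) = hatElement (holderMetric N hN α h0 h1) α p k v) ∧
      (∀ f, ‖T f‖ ≤ ((K₁ ^ α) ^ p * (2 ^ d * ((d : ℝ) ^ α) ^ p)) ^ (1 / p) * ‖f‖) ∧
      ∀ x, ‖T.symm x‖ ≤ ((K₂ ^ α) ^ p * (2 ^ (d + 1) * (1 / (1 - 2 ^ (p * (α - 1))) +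
        1 / (1 - 2 ^ (-(p * α)))))) ^ (1 / p) * ‖x‖ := by
  have hA := two_le_one_div_one_sub_two_rpow (mul_pos hp0 (sub_pos.2 h1))
    (by nlinarith : p * (1 - α) ≤ 1)
  rw [show -(p * (1 - α)) = p * (α - 1) by ring] at hA
  have hB := two_le_one_div_one_sub_two_rpow (mul_pos hp0 h0) (by nlinarith : p * α ≤ 1)
  have hAB : 0 ≤ 1 / (1 - (2 : ℝ) ^ (p * (α - 1))) + 1 / (1 - 2 ^ (-(p * α))) := by linarith
  obtain ⟨T, hunit, hT, hT'⟩ := exists_isomorphism_of_biorthogonal hp0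
    (h := fun v : dyadicPoints d => molHat (holderMetric N hN α h0 h1) α p (level v) v)
    (by positivity) (by positivity)
    (fun v => norm_molHat_le N hN h0 h1 hp0 hK₁ hup (mem_newPoints_level v))
    (sum_hatCoord_le N hN h0 h1 hp0 hp1 hK₂ hlow) (hatCoord_molHat_self _ α p)
    (fun _ _ h => hatCoord_molHat_of_ne _ α p h)
    (fun S hS hmem => mem_of_hat_mem h0 hp0
      (fun x y _ => holderMetric_dist_le N hN h0 h1 hK₁ hup x y) S hS fun k v hv => by
      have h := hmem ⟨v, Set.mem_iUnion.2 ⟨k, hv⟩⟩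
      rwa [level_eq hv] at h)
  refine ⟨T, fun k v hv => ?_, hT, hT'⟩
  rw [hunit, level_eq hv]
  exact coe_molHat (holderMetric N hN α h0 h1) α p k (v : UnitCube d)

end Isomorphism

theorem opNorm_nonneg {E F : Type*} [AddCommGroup E] [Module ℝ E] [Norm E] [AddCommGroup F]
    [Module ℝ F] [Norm F] (T : E ≃ₗ[ℝ] F) : 0 ≤ opNorm T :=
  Real.sInf_nonneg fun _ h => h.1

theorem opNorm_le {E F : Type*} [AddCommGroup E] [Module ℝ E] [Norm E] [AddCommGroup F]
    [Module ℝ F] [Norm F] (T : E ≃ₗ[ℝ] F) {C : ℝ} (hC : 0 ≤ C) (h : ∀ x, ‖T x‖ ≤ C * ‖x‖) :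
    opNorm T ≤ C :=
  csInf_le ⟨0, fun _ h => h.1⟩ ⟨hC, h⟩

theorem nonempty_dyadicPoints_equiv_nat {d : ℕ} (hd : 1 ≤ d) : Nonempty (dyadicPoints d ≃ ℕ) := by
  have hcount : (dyadicPoints d).Countable := Set.countable_iUnion fun k =>
    ((Set.finite_range (gridPoint (d := d) k)).subset (newPoints_subset_grid k)).countable
  have : Countable (dyadicPoints d) := hcount.to_subtype
  have hmem : ∀ k, gridPoint (d := d) k (fun _ => 1) ∈ newPoints d k := fun k => by
    cases k with
    | zero =>
      refine ⟨⟨_, rfl⟩, fun h => ?_⟩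
      have h' := congrArg (fun z : unitInterval => (z : ℝ)) (congrFun h (⟨0, hd⟩ : Fin d))
      simp [gridPoint_apply] at h'
    | succ k =>
      refine ⟨⟨_, rfl⟩, ?_⟩
      rintro ⟨j, hj⟩
      have h' := congrArg (fun z : unitInterval => (z : ℝ)) (congrFun hj (⟨0, hd⟩ : Fin d))
      simp only [gridPoint_apply] at h'
      generalize ((j ⟨0, hd⟩ : Fin (2 ^ k + 1)) : ℕ) = a at h'
      rw [Fin.val_one', Nat.mod_eq_of_lt (by rw [pow_succ]; have := Nat.one_le_two_pow (n := k); omega),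
        pow_succ, div_eq_div_iff (by positivity) (by positivity)] at h'
      have h2 : (a : ℝ) * 2 = 1 := by
        have hk : (2 : ℝ) ^ k ≠ 0 := by positivity
        apply mul_left_cancel₀ hk
        push_cast at h'
        linarith
      have h3 : a * 2 = 1 := by exact_mod_cast h2
      omega
  have : Infinite (dyadicPoints d) := by
    refine Infinite.of_injective
      (fun k : ℕ => (⟨gridPoint k fun _ => 1, Set.mem_iUnion.2 ⟨k, hmem k⟩⟩ : dyadicPoints d))
      fun k l h => ?_
    have h' : gridPoint (d := d) k (fun _ => 1) = gridPoint l fun _ => 1 := congrArg Subtype.val h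
    exact newPoints_level_unique (hmem k) (h' ▸ hmem l)
  exact nonempty_equiv_of_countable

end

theorem mainTheorem2 (d : ℕ) (hd : 1 ≤ d) (α : ℝ) (h0 : 0 < α) (h1 : α < 1)
    (p : ℝ) (hp0 : 0 < p) (hp1 : p ≤ 1) :
    (∀ (N : Seminorm ℝ (Fin d → ℝ)) (hN : ∀ x, N x = 0 → x = 0),
      ∃ T : CubeFree N hN α h0 h1 p ≃ₗ[ℝ] Ellp ℕ p, IsIsomorphism T) ∧
    (∃ T : Ellp (dyadicPoints d) p ≃ₗ[ℝ] CubeFree (l1Norm d) l1Norm_definite α h0 h1 p,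
      IsIsomorphism T ∧
      (∀ (k : ℕ) (v : dyadicPoints d), (v : UnitCube d) ∈ newPoints d k →
        T (unitVec p v) = hatElement (holderMetric (l1Norm d) l1Norm_definite α h0 h1) α p k v) ∧
      opNorm T * opNorm T.symm ≤ constC p (2 ^ d) * constRho α p ^ d * constTau d α p ^ d) ∧
    banachMazurDist (CubeFree (l1Norm d) l1Norm_definite α h0 h1 p) (Ellp ℕ p) ≤
      ENNReal.ofReal (constC p (2 ^ d) * constRho α p ^ d * constTau d α p ^ d) := by
  obtain ⟨e⟩ := nonempty_dyadicPoints_equiv_nat hd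
  refine ⟨fun N hN => ?_, ?_⟩
  · obtain ⟨K₁, K₂, hK₁, hK₂, hup, hlow⟩ := exists_equivalence_constants N hN
    obtain ⟨T, -, hT, hT'⟩ := exists_hat_isomorphism N hN h0 h1 hp0 hp1 hK₁ hK₂ hup hlow
    exact ⟨T.symm.trans (Ellp.reindex e hp0),
      ⟨_, fun x => (Ellp.norm_reindex e hp0 _).trans_le (hT' x)⟩,
      ⟨_, fun f => (hT ((Ellp.reindex e hp0).symm f)).trans_eq (by rw [Ellp.norm_reindex_symm])⟩⟩
  · obtain ⟨T, hunit, hT, hT'⟩ := exists_hat_isomorphism (l1Norm d) l1Norm_definite h0 h1 hp0 hp1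
      zero_le_one zero_le_one (fun x => (one_mul _).ge) (fun x => (one_mul _).ge)
    simp only [Real.one_rpow, one_mul] at hT hT'
    have hA := two_le_one_div_one_sub_two_rpow (mul_pos hp0 (sub_pos.2 h1))
      (by nlinarith : p * (1 - α) ≤ 1)
    rw [show -(p * (1 - α)) = p * (α - 1) by ring] at hA
    have hB := two_le_one_div_one_sub_two_rpow (mul_pos hp0 h0) (by nlinarith : p * α ≤ 1)
    have hAB : 0 ≤ 1 / (1 - (2 : ℝ) ^ (p * (α - 1))) + 1 / (1 - 2 ^ (-(p * α))) := by linarith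
    have hconst := const_product_le hd h0 h1 hp0 hp1
    refine ⟨⟨T, ⟨⟨_, hT⟩, _, hT'⟩, hunit, ?_⟩, ?_⟩
    · exact (mul_le_mul (opNorm_le T (by positivity) hT) (opNorm_le T.symm (by positivity) hT')
        (opNorm_nonneg _) (by positivity)).trans hconst
    · set S := T.symm.trans (Ellp.reindex e hp0)
      have hS : ∀ x, ‖S x‖ ≤ _ * ‖x‖ := fun x => (Ellp.norm_reindex e hp0 _).trans_le (hT' x)
      have hS' : ∀ f, ‖S.symm f‖ ≤ _ * ‖f‖ := fun f =>
        (hT ((Ellp.reindex e hp0).symm f)).trans_eq (by rw [Ellp.norm_reindex_symm])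
      refine (iInf₂_le S ⟨⟨_, hS⟩, _, hS'⟩).trans (ENNReal.ofReal_le_ofReal ?_)
      rw [mul_comm]
      exact (mul_le_mul (opNorm_le S.symm (by positivity) hS') (opNorm_le S (by positivity) hS)
        (opNorm_nonneg _) (by positivity)).trans hconst
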